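/- Let $d\ge 0$ be an integer, let $c_{ij}\in W^{1,\infty}({\bf R}^d)$, $i,j\in\{1,\ldots,d\}$, be real-valued, and let $\Omega$ be a (Lebesgue) measurable subset of ${\bf R}^d$. For $i\in\{1,\ldots,d\}$ let $Y_i$ be the closure in $L_2({\bf R}^d)$ of the operator $\varphi\mapsto\sum_{j=1}^d c_{ij}\,\partial_j\varphi$ with domain $C_c^\infty({\bf R}^d)$, and for real-valued $\psi\in C_c^\infty({\bf R}^d)$ let $Y_\psi$ be the closure in $L_2({\bf R}^d)$ of the operator $\varphi\mapsto\sum_{i,j=1}^d c_{ij}\,(\partial_i\psi)\,\partial_j\varphi$ with domain $C_c^\infty({\bf R}^d)$. Each $Y_i$ and each $Y_\psi$ is the generator of a unique strongly continuous one-parameter group on $L_2({\bf R}^d)$; denote these groups by $T^{(i)}=(T^{(i)}_t)_{t\in{\bf R}}$ and $T^\psi=(T^\psi_t)_{t\in{\bf R}}$. Let $L_2(\Omega)\subseteq L_2({\bf R}^d)$ be the subspace of functions that vanish almost everywhere outside $\Omega$. Then the following conditions are equivalent. 1. $T^{(i)}_t L_2(\Omega)=L_2(\Omega)$ for all $i\in\{1,\ldots,d\}$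 and all $t\in{\bf R}$. 2. $T^\psi_t L_2(\Omega)=L_2(\Omega)$ for all real-valued $\psi\in C_c^\infty({\bf R}^d)$ and all $t\in{\bf R}$. Here $L_2$ may be taken over the real or over the complex numbers. -/

import Mathlib

open MeasureTheory
open scoped ContDiff

noncomputable section

namespace CoordinateFlows

/-- `IsTestFunction φ`: the function `φ : ℝ^d → F` belongs to `C_c^∞(ℝ^d)`. -/
def IsTestFunction {d : ℕ} {F : Type*} [NormedAddCommGroup F] [NormedSpace ℝ F]
    (φ : EuclideanSpace ℝ (Fin d) → F) : Prop :=
  ContDiff ℝ ∞ φ ∧ HasCompactSupport φ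

/-- The classical partial derivative `∂_j φ`. -/
def partialDeriv {d : ℕ} {F : Type*} [NormedAddCommGroup F] [NormedSpace ℝ F]
    (j : Fin d) (φ : EuclideanSpace ℝ (Fin d) → F) : EuclideanSpace ℝ (Fin d) → F :=
  fun x => fderiv ℝ φ x (EuclideanSpace.single j 1)

/-- `HasWeakPartial j u v`: the function `v` is the weak partial derivative `∂_j u`. It is used only
for essentially bounded `u` and `v`, for which both integrals converge absolutely. -/
def HasWeakPartial {d : ℕ} (j : Fin d) (u v : EuclideanSpace ℝ (Fin d) → ℝ) : Prop :=
  ∀ φ : EuclideanSpace ℝ (Fin d) → ℝ, IsTestFunction φ →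
    ∫ x, u x * partialDeriv j φ x = - ∫ x, v x * φ x

/-- `u ∈ W^{1,∞}(ℝ^d)`: `u` is in `L_∞` and so are its first-order weak partial derivatives. -/
def MemW1Inf {d : ℕ} (u : EuclideanSpace ℝ (Fin d) → ℝ) : Prop :=
  MemLp u ⊤ volume ∧
    ∀ j : Fin d, ∃ v : EuclideanSpace ℝ (Fin d) → ℝ, MemLp v ⊤ volume ∧ HasWeakPartial j u v

/-- The Hilbert space `L_2(ℝ^d)` of `𝕜`-valued functions. -/
abbrev L2 (𝕜 : Type*) [RCLike 𝕜] (d : ℕ) : Type _ :=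
  Lp 𝕜 2 (volume : Measure (EuclideanSpace ℝ (Fin d)))

/-- The subspace `L_2(Ω)` of `L_2(ℝ^d)`: the classes that vanish almost everywhere outside `Ω`. -/
def L2On (𝕜 : Type*) [RCLike 𝕜] {d : ℕ} (Ω : Set (EuclideanSpace ℝ (Fin d))) : Set (L2 𝕜 d) :=
  {f | ∀ᵐ x ∂(volume : Measure (EuclideanSpace ℝ (Fin d))), x ∉ Ω → f x = 0}

/-- The first-order operator `φ ↦ ∑_j b_j ∂_j φ` with real coefficients `b_j`. -/
def vectorField {𝕜 : Type*} [RCLike 𝕜] {d : ℕ} (b : Fin d → EuclideanSpace ℝ (Fin d) → ℝ)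
    (φ : EuclideanSpace ℝ (Fin d) → 𝕜) : EuclideanSpace ℝ (Fin d) → 𝕜 :=
  fun x => ∑ j, b j x • partialDeriv j φ x

/-- The graph, in `L_2 × L_2`, of the operator `∑_j b_j ∂_j` with domain `C_c^∞(ℝ^d)`. -/
def vectorFieldGraph (𝕜 : Type*) [RCLike 𝕜] {d : ℕ}
    (b : Fin d → EuclideanSpace ℝ (Fin d) → ℝ) : Set (L2 𝕜 d × L2 𝕜 d) :=
  {p | ∃ φ : EuclideanSpace ℝ (Fin d) → 𝕜, IsTestFunction φ ∧
    p.1 =ᵐ[volume] φ ∧ p.2 =ᵐ[volume] vectorField b φ}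

/-- `T` is a strongly continuous one-parameter group of bounded operators on `X`. -/
structure IsC0Group {𝕜 X : Type*} [RCLike 𝕜] [NormedAddCommGroup X] [NormedSpace 𝕜 X]
    (T : ℝ → X →L[𝕜] X) : Prop where
  map_zero : T 0 = ContinuousLinearMap.id 𝕜 X
  map_add : ∀ s t : ℝ, T (s + t) = (T s).comp (T t)
  continuous : ∀ f : X, Continuous fun t => T t f

/-- `IsFlow b T`: `T` is the strongly continuous one-parameter group on `L_2(ℝ^d)` generated by the
`L_2`-closure of the operator `∑_j b_j ∂_j` on `C_c^∞(ℝ^d)`. The generator of `T` is the operator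
`f ↦ g`, where `g` is the derivative at `0` of `t ↦ T t f`, defined for those `f` for which this
derivative exists in `L_2`; its graph is required to be the closure of the graph of
`∑_j b_j ∂_j` on `C_c^∞(ℝ^d)`. -/
structure IsFlow {𝕜 : Type*} [RCLike 𝕜] {d : ℕ} (b : Fin d → EuclideanSpace ℝ (Fin d) → ℝ)
    (T : ℝ → L2 𝕜 d →L[𝕜] L2 𝕜 d) : Prop where
  isC0Group : IsC0Group T
  generator : {p : L2 𝕜 d × L2 𝕜 d | HasDerivAt (fun t : ℝ => T t p.1) p.2 0} =
    closure (vectorFieldGraph 𝕜 b)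

/-- The coefficients `b_j = ∑_i c_{ij} ∂_i ψ` of the operator `Y_ψ`. -/
def gradCoeff {d : ℕ} (c : Fin d → Fin d → EuclideanSpace ℝ (Fin d) → ℝ)
    (ψ : EuclideanSpace ℝ (Fin d) → ℝ) : Fin d → EuclideanSpace ℝ (Fin d) → ℝ :=
  fun j x => ∑ i, c i j x * partialDeriv i ψ x

end CoordinateFlows

end

/-! Write `div(χ b)` for `divForm b v χ`. For a vector field `b` with coefficients in `W^{1,∞}`,
invariance of `L_2(Ω)` under the flow of `b` is equivalent to the weak equation `∑_j b_j ∂_j 1_Ω =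
0`, that is, `∫_Ω div(χ b) = 0` for every test function `χ` (`image_L2On_eq_iff`). This condition
sees `χ` and `b` only through the product `χ b`, whereas the groups themselves depend on `b`
nonlinearly. Since `χ ∑_i (∂_i ψ) c_i = ∑_i (χ ∂_i ψ) c_i`, the condition for all `c_i` implies that
for `∑_i (∂_i ψ) c_i`. Conversely, if `ψ` agrees with the coordinate `x_i` near the support of `χ`,
then the condition for `ψ` and `χ` is the one for `c_i` and `χ` (`weaklyInvariant_gradCoeff_iff`).

The equivalence passes through the projection `P f = 1_Ω f`. The group is composition with the flow
of a Lipschitz representative of `b`, so it preserves disjointness of supports; hence invariance of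
`L_2(Ω)` forces `P` to commute with the group (`commute_of_image_eq`). Commutation means that `P`
preserves the generator `Y`, and testing `Y P φ = P Y φ` with a cut-off `φ` yields the weak equation
(`weaklyInvariant_of_commute`). In the other direction the weak equation makes `P φ` a weak solution
of `Y (P φ) = P Y φ`. Weak solutions are strong (`IsWeakSolution.mem_closure_graph`): a duality
argument with the resolvents of `Y` and `-Y` proves this, the divergence of `b` being a bounded
perturbation. Then `P` preserves the generator and so commutes with the group
(`IsC0Group.intertwine`).

Existence of the groups (`IsGlobalFlow.exists_isFlow`) rests on the fact that the compactly
supported Lipschitz functions form a flow-invariant dense set inside the domain of the closure of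
`Y`. -/

noncomputable section

namespace CoordinateFlows

open Filter Topology Set
open scoped NNReal ENNReal Convolution ComplexConjugate

/-! ### Strongly continuous groups and their generators -/

section Groups

variable {X Y : Type*} [NormedAddCommGroup X] [NormedSpace ℝ X] [NormedAddCommGroup Y]
  [NormedSpace ℝ Y]

theorem IsC0Group.restrictScalars {𝕜 : Type*} [RCLike 𝕜] [NormedSpace 𝕜 X]
    [LinearMap.CompatibleSMul X X ℝ 𝕜] {T : ℝ → X →L[𝕜] X} (hT : IsC0Group T) :
    IsC0Group (fun t => (T t).restrictScalars ℝ) where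
  map_zero := by ext x; simp [hT.map_zero]
  map_add s t := by ext x; simp [hT.map_add]
  continuous f := hT.continuous f

variable {T : ℝ → X →L[ℝ] X} {S : ℝ → Y →L[ℝ] Y}

/-- The pair `(f, g)` belongs to the graph of the generator of `T`. -/
def InGenerator (T : ℝ → X →L[ℝ] X) (f g : X) : Prop :=
  HasDerivAt (fun t => T t f) g 0

namespace IsC0Group

theorem apply_zero (hT : IsC0Group T) (x : X) : T 0 x = x := by simp [hT.map_zero]

theorem apply_add (hT : IsC0Group T) (s t : ℝ) (x : X) : T (s + t) x = T s (T t x) := by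
  simp [hT.map_add]

theorem apply_neg_apply (hT : IsC0Group T) (t : ℝ) (x : X) : T (-t) (T t x) = x := by
  rw [← hT.apply_add, neg_add_cancel, hT.apply_zero]

theorem apply_apply_neg (hT : IsC0Group T) (t : ℝ) (x : X) : T t (T (-t) x) = x := by
  rw [← hT.apply_add, add_neg_cancel, hT.apply_zero]

theorem comp_neg (hT : IsC0Group T) : IsC0Group (fun t => T (-t)) where
  map_zero := by simp [hT.map_zero]
  map_add s t := by rw [neg_add, hT.map_add]
  continuous f := (hT.continuous f).comp continuous_neg

theorem exp_smul (hT : IsC0Group T) (c : ℝ) : IsC0Group (fun t => Real.exp (-(c * t)) • T t) where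
  map_zero := by simp [hT.map_zero]
  map_add s t := by
    ext x
    simp [hT.map_add, mul_add, Real.exp_add, smul_smul, mul_comm]
  continuous f := by
    have := hT.continuous f
    simp only [smul_apply]
    fun_prop

theorem exists_bound [CompleteSpace X] (hT : IsC0Group T) (a : ℝ) :
    ∃ M, 0 < M ∧ ∀ t ∈ Icc (-a) a, ‖T t‖ ≤ M := by
  obtain ⟨C, hC⟩ := banach_steinhaus (g := fun t : Icc (-a) a => T t) (fun x => by
    obtain ⟨C, hC⟩ := isCompact_Icc.exists_bound_of_continuousOn
      (hT.continuous x).continuousOn (s := Icc (-a) a)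
    exact ⟨C, fun t => hC t t.2⟩)
  exact ⟨max C 1, by positivity, fun t ht => (hC ⟨t, ht⟩).trans (le_max_left _ _)⟩

/-- Strong continuity is upgraded to joint continuity by the uniform bound on compact time
intervals. -/
theorem tendsto_apply [CompleteSpace X] (hT : IsC0Group T) {ι : Type*} {l : Filter ι} {τ : ι → ℝ}
    {u : ι → X} {t : ℝ} {x : X} (hτ : Tendsto τ l (𝓝 t)) (hu : Tendsto u l (𝓝 x)) :
    Tendsto (fun i => T (τ i) (u i)) l (𝓝 (T t x)) := by
  obtain ⟨M, hM, hb⟩ := hT.exists_bound (|t| + 1)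
  have h1 : Tendsto (fun i => T (τ i) x) l (𝓝 (T t x)) := (hT.continuous x).continuousAt.tendsto.comp hτ
  have h2 : Tendsto (fun i => T (τ i) (u i - x)) l (𝓝 0) := by
    have h3 : Tendsto (fun i => M * ‖u i - x‖) l (𝓝 0) := by
      have := (hu.sub_const x).norm.const_mul M
      simpa using this
    refine squeeze_zero_norm' ?_ h3
    have hnb : ∀ᶠ s in 𝓝 t, s ∈ Icc (-(|t| + 1)) (|t| + 1) := by
      refine Icc_mem_nhds ?_ ?_
      · linarith [neg_abs_le t]
      · linarith [le_abs_self t]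
    filter_upwards [hτ.eventually hnb] with i hi
    exact (T (τ i)).le_of_opNorm_le (hb _ hi) _
  simpa using h1.add h2

theorem continuous_uncurry [CompleteSpace X] (hT : IsC0Group T) :
    Continuous (fun p : X × ℝ => T p.2 p.1) :=
  continuous_iff_continuousAt.2 fun _ => hT.tendsto_apply continuousAt_snd continuousAt_fst

theorem hasDerivAt (hT : IsC0Group T) {f g : X} (h : InGenerator T f g) (s : ℝ) :
    HasDerivAt (fun t => T t f) (T s g) s := by
  have h1 : HasDerivAt (fun t => T (t - s) f) g s := by
    have h0 : HasDerivAt (fun t => T t f) g (s - s) := by rw [sub_self]; exact h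
    exact h0.comp_sub_const s s
  have h2 := (T s).hasFDerivAt.comp_hasDerivAt s h1
  refine h2.congr_of_eventuallyEq (Eventually.of_forall fun t => ?_)
  simp [← hT.apply_add]

theorem inGenerator_apply (hT : IsC0Group T) {f g : X} (h : InGenerator T f g) (s : ℝ) :
    InGenerator T (T s f) (T s g) := by
  refine ((T s).hasFDerivAt.comp_hasDerivAt 0 h).congr_of_eventuallyEq
    (Eventually.of_forall fun t => ?_)
  simp [← hT.apply_add, add_comm]

theorem integral_eq_sub [CompleteSpace X] (hT : IsC0Group T) {f g : X} (h : InGenerator T f g) (t : ℝ) :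
    ∫ s in (0 : ℝ)..t, T s g = T t f - f := by
  rw [intervalIntegral.integral_eq_sub_of_hasDerivAt (fun s _ => hT.hasDerivAt h s)
    ((hT.continuous g).intervalIntegrable _ _), hT.apply_zero]

theorem inGenerator_of_integral_eq_sub [CompleteSpace X] (hT : IsC0Group T) {f g : X}
    (h : ∀ t, ∫ s in (0 : ℝ)..t, T s g = T t f - f) : InGenerator T f g := by
  have h1 : HasDerivAt (fun t => (∫ s in (0 : ℝ)..t, T s g) + f) (T 0 g) 0 :=
    ((hT.continuous g).integral_hasStrictDerivAt 0 0).hasDerivAt.add_const f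
  rw [hT.apply_zero] at h1
  exact h1.congr_of_eventuallyEq (Eventually.of_forall fun t => by simp [h])

theorem continuous_integral [CompleteSpace X] (hT : IsC0Group T) (a b : ℝ) :
    Continuous fun f => ∫ s in a..b, T s f :=
  intervalIntegral.continuous_parametric_intervalIntegral_of_continuous' hT.continuous_uncurry _ _

/-- The derivative at zero is not visibly stable under limits, but the equivalent integrated
identity is an equality of continuous functions of the pair for each `t`. -/
theorem isClosed_generator [CompleteSpace X] (hT : IsC0Group T) :
    IsClosed {p : X × X | InGenerator T p.1 p.2} := by
  have : {p : X × X | InGenerator T p.1 p.2} =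
      ⋂ t, {p : X × X | ∫ s in (0 : ℝ)..t, T s p.2 = T t p.1 - p.1} := by
    ext p
    simp only [mem_ofPred_eq, mem_iInter]
    exact ⟨fun h t => hT.integral_eq_sub h t, hT.inGenerator_of_integral_eq_sub⟩
  rw [this]
  refine isClosed_iInter fun t => isClosed_eq ?_ ?_
  · exact (hT.continuous_integral 0 t).comp continuous_snd
  · fun_prop

theorem inGenerator_integral [CompleteSpace X] (hT : IsC0Group T) (f : X) (h : ℝ) :
    InGenerator T (∫ s in (0 : ℝ)..h, T s f) (T h f - f) := by
  have hc := hT.continuous f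
  have h1 : HasDerivAt (fun t => (∫ s in (0 : ℝ)..(t + h), T s f) - ∫ s in (0 : ℝ)..t, T s f)
      (T h f - f) 0 := by
    have h2 := (hc.integral_hasStrictDerivAt 0 0).hasDerivAt
    have h3 := (hc.integral_hasStrictDerivAt 0 (0 + h)).hasDerivAt.comp_add_const 0 h
    simpa [hT.apply_zero] using h3.fun_sub h2
  refine h1.congr_of_eventuallyEq (Eventually.of_forall fun t => ?_)
  dsimp only
  rw [← ContinuousLinearMap.intervalIntegral_comp_comm _ (hc.intervalIntegrable _ _)]
  simp_rw [← hT.apply_add]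
  rw [intervalIntegral.integral_interval_sub_left (hc.intervalIntegrable _ _)
    (hc.intervalIntegrable _ _)]
  have := intervalIntegral.integral_comp_add_left (a := 0) (b := h) (fun s => T s f) t
  simpa using this

theorem tendsto_average [CompleteSpace X] (hT : IsC0Group T) (f : X) :
    Tendsto (fun h : ℝ => h⁻¹ • ∫ s in (0 : ℝ)..h, T s f) (𝓝[>] 0) (𝓝 f) := by
  have h2 := ((hT.continuous f).integral_hasStrictDerivAt 0 0).hasDerivAt.tendsto_slope_zero_right
  simpa [hT.apply_zero] using h2

/-- A product rule in which only the value `u s`, not the whole curve, has to lie in the domain of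
the generator. -/
theorem hasDerivAt_apply [CompleteSpace X] (hT : IsC0Group T) {u : ℝ → X} {u' v : X} {s : ℝ}
    (hu : HasDerivAt u u' s) (hv : InGenerator T (u s) v) :
    HasDerivAt (fun r => T r (u r)) (T s (u' + v)) s := by
  have h1 := hT.hasDerivAt hv s
  rw [hasDerivAt_iff_tendsto_slope] at h1 hu ⊢
  have h2 : Tendsto (fun r => T r (slope u s r)) (𝓝[≠] s) (𝓝 (T s u')) :=
    hT.tendsto_apply (tendsto_id.mono_left nhdsWithin_le_nhds) hu
  rw [_root_.map_add]
  refine (h2.add h1).congr fun r => ?_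
  simp [slope_def_module, smul_sub]

/-- An operator that maps the generator of `T` into the generator of `S` intertwines the groups. -/
theorem intertwine [CompleteSpace Y] (hT : IsC0Group T) (hS : IsC0Group S) (P : X →L[ℝ] Y)
    (hP : ∀ f g, InGenerator T f g → InGenerator S (P f) (P g))
    (hd : Dense {f | ∃ g, InGenerator T f g}) (t : ℝ) (f : X) : P (T t f) = S t (P f) := by
  revert f
  refine fun f => hd.induction (P := fun f => P (T t f) = S t (P f)) ?_
    (isClosed_eq (by fun_prop) (by fun_prop)) f
  rintro f ⟨g, hfg⟩
  -- The curve `S (-r) P (T r f)` is constant: the contributions of the two generators cancel.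
  have key : ∀ r, HasDerivAt (fun r => S (-r) (P (T r f))) 0 r := fun r => by
    have h1 : HasDerivAt (fun r => P (T r f)) (P (T r g)) r :=
      P.hasFDerivAt.comp_hasDerivAt r (hT.hasDerivAt hfg r)
    have h2 : InGenerator (fun t => S (-t)) (P (T r f)) (-P (T r g)) := by
      have h3 := hP _ _ (hT.inGenerator_apply hfg r)
      have h4 : HasDerivAt (fun t => S t (P (T r f))) (P (T r g)) (0 - 0) := by
        rw [sub_zero]; exact h3
      simpa [InGenerator] using h4.comp_const_sub 0 0
    simpa using hS.comp_neg.hasDerivAt_apply h1 h2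
  have h5 := is_const_of_deriv_eq_zero (fun r => (key r).differentiableAt)
    (fun r => (key r).deriv) t 0
  simp only [neg_zero, hT.apply_zero, hS.apply_zero] at h5
  rw [← h5, hS.apply_apply_neg]

/-- A closed restriction of the generator to a dense set that is invariant under the group is the
whole generator. -/
theorem generator_subset_of_invariant [CompleteSpace X] (hT : IsC0Group T) (G : Submodule ℝ (X × X))
    (hG : IsClosed (G : Set (X × X))) (hGT : ∀ p ∈ G, InGenerator T p.1 p.2) {D : Set X}
    (hD : Dense D) (hinv : ∀ f ∈ D, ∀ t, T t f ∈ D) (hDG : ∀ f ∈ D, ∃ g, (f, g) ∈ G)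
    {f g : X} (h : InGenerator T f g) : (f, g) ∈ G := by
  -- Averages over `[0, r]` land in `G`. For `f` in `D` the orbit of the pair stays in the closed
  -- convex set `G`, hence so does its mean. Both components depend continuously on `f` alone, so
  -- density of `D` removes the restriction on `f`.
  have key : ∀ r : ℝ, 0 < r → ∀ f : X,
      (r⁻¹ • ∫ s in (0 : ℝ)..r, T s f, r⁻¹ • (T r f - f)) ∈ G := fun r hr f => by
    refine hD.induction (P := fun f => (r⁻¹ • ∫ s in (0 : ℝ)..r, T s f, r⁻¹ • (T r f - f)) ∈ G)
      ?_ (hG.preimage (f := fun f => (r⁻¹ • ∫ s in (0 : ℝ)..r, T s f, r⁻¹ • (T r f - f)))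
        (((hT.continuous_integral 0 r).const_smul _).prodMk (by fun_prop))) f
    intro f hf
    obtain ⟨g, hg⟩ := hDG f hf
    have hgen := hGT _ hg
    have hmem : ∀ s, (T s f, T s g) ∈ G := fun s => by
      obtain ⟨g', hg'⟩ := hDG _ (hinv f hf s)
      have := (hGT _ hg').unique (hT.inGenerator_apply hgen s)
      dsimp only at this
      rwa [← this]
    have hc : Continuous fun s => (T s f, T s g) := (hT.continuous f).prodMk (hT.continuous g)
    have hav := G.convex.set_average_mem hG (μ := volume) (t := Ioc 0 r) (f := fun s => (T s f, T s g))
      (by simp [hr]) (by simp) (Eventually.of_forall hmem)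
      (hc.integrableOn_Ioc)
    rw [← Set.uIoc_of_le hr.le, interval_average_eq, sub_zero] at hav
    have e1 : ∫ s in (0 : ℝ)..r, (T s f, T s g) =
        (∫ s in (0 : ℝ)..r, T s f, ∫ s in (0 : ℝ)..r, T s g) := by
      refine Prod.ext ?_ ?_
      · exact (ContinuousLinearMap.intervalIntegral_comp_comm (ContinuousLinearMap.fst ℝ X X)
          (hc.intervalIntegrable _ _)).symm
      · exact (ContinuousLinearMap.intervalIntegral_comp_comm (ContinuousLinearMap.snd ℝ X X)
          (hc.intervalIntegrable _ _)).symm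
    rw [e1, hT.integral_eq_sub hgen] at hav
    exact hav
  have hlim : Tendsto (fun r : ℝ => (r⁻¹ • ∫ s in (0 : ℝ)..r, T s f, r⁻¹ • (T r f - f)))
      (𝓝[>] 0) (𝓝 (f, g)) := by
    refine (hT.tendsto_average f).prodMk_nhds ?_
    have := HasDerivAt.tendsto_slope_zero_right h
    simpa [hT.apply_zero] using this
  exact hG.mem_of_tendsto hlim (eventually_mem_nhdsWithin.mono fun r hr => key r hr f)

theorem inGenerator_exp_smul_iff (hT : IsC0Group T) (c : ℝ) {f g : X} :
    InGenerator (fun t => Real.exp (-(c * t)) • T t) f g ↔ InGenerator T f (c • f + g) := by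
  have aux : ∀ c : ℝ, HasDerivAt (fun t => Real.exp (-(c * t))) (-c) 0 := fun c => by
    have h1 : HasDerivAt (fun t : ℝ => -(c * t)) (-c) 0 := by
      simpa using ((hasDerivAt_id (0 : ℝ)).const_mul c).fun_neg
    simpa using h1.exp
  constructor
  · intro h
    have h1 := HasDerivAt.fun_smul (aux (-c)) h
    have e : (fun t => Real.exp (-(-c * t)) • (Real.exp (-(c * t)) • T t f)) = fun t => T t f := by
      ext t
      rw [smul_smul, ← Real.exp_add]; simp
    unfold InGenerator
    rw [← e]
    refine h1.congr_deriv ?_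
    simp [hT.apply_zero, add_comm]
  · intro h
    refine (HasDerivAt.fun_smul (aux c) h).congr_deriv ?_
    simp [hT.apply_zero]

/-- The resolvent of the generator exists for large `c`, and its norm tends to zero. -/
theorem eventually_exists_resolvent [CompleteSpace X] (hT : IsC0Group T) {ε : ℝ} (hε : 0 < ε) :
    ∀ᶠ c : ℝ in atTop, ∀ f : X, ∃ u, InGenerator T u (c • u - f) ∧ ‖u‖ ≤ ε * ‖f‖ := by
  obtain ⟨M, hM, hb⟩ := hT.exists_bound 1
  -- The factor `2` leaves room for the bound on `(1 - K)⁻¹` below, where `‖K‖ ≤ 1 / 2`.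
  obtain ⟨r, hr0, hr1, hrε⟩ : ∃ r : ℝ, 0 < r ∧ r ≤ 1 ∧ M * r * 2 ≤ ε := by
    refine ⟨min 1 (ε / (2 * M)), by positivity, min_le_left _ _, ?_⟩
    calc M * min 1 (ε / (2 * M)) * 2 ≤ M * (ε / (2 * M)) * 2 := by gcongr; exact min_le_right _ _
      _ = ε := by field_simp
  have hlim : Tendsto (fun c : ℝ => Real.exp (-(c * r)) * M) atTop (𝓝 0) := by
    have h1 : Tendsto (fun c : ℝ => c * r) atTop atTop := tendsto_id.atTop_mul_const hr0
    simpa using (Real.tendsto_exp_neg_atTop_nhds_zero.comp h1).mul_const M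
  filter_upwards [hlim.eventually (ge_mem_nhds (show (0 : ℝ) < 1 / 2 by norm_num)),
    eventually_ge_atTop 0] with c hc hc0 f
  -- With `v = (1 - K)⁻¹ f` the resolvent is a proper integral `u = ∫_0^r e^{-cs} T_s v ds`: for the
  -- rescaled group, whose generator is `Y - c`, one gets `(Y - c) u = K v - v = -f`. Summing the
  -- geometric series would turn this into the usual Laplace integral over the half-line.
  set K : X →L[ℝ] X := Real.exp (-(c * r)) • T r with hK
  have hKn : ‖K‖ ≤ 1 / 2 := by
    rw [hK, norm_smul, Real.norm_of_nonneg (Real.exp_pos _).le]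
    refine le_trans ?_ hc
    gcongr
    exact hb r ⟨by linarith, hr1⟩
  obtain ⟨a, ha⟩ := (isUnit_one_sub_of_norm_lt_one (x := K) (by linarith)).exists_right_inv
  set v := a f
  have hv : v - K v = f := by
    have := congrArg (fun L : X →L[ℝ] X => L f) ha
    simpa using this
  have hvn : ‖v‖ ≤ 2 * ‖f‖ := by
    have h1 : ‖K v‖ ≤ 1 / 2 * ‖v‖ := K.le_of_opNorm_le hKn v
    have h2 : ‖v‖ ≤ ‖f‖ + ‖K v‖ := by
      calc ‖v‖ = ‖f + K v‖ := by rw [← hv]; simp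
        _ ≤ _ := norm_add_le _ _
    linarith
  have hS := hT.exp_smul c
  refine ⟨∫ s in (0 : ℝ)..r, (Real.exp (-(c * s)) • T s) v, ?_, ?_⟩
  · have h1 := (hT.inGenerator_exp_smul_iff c).1 (hS.inGenerator_integral v r)
    convert h1 using 1
    rw [← hv, hK, sub_sub_eq_add_sub]
    abel
  · have h1 := intervalIntegral.norm_integral_le_of_norm_le_const (a := 0) (b := r)
      (f := fun s => (Real.exp (-(c * s)) • T s) v) (C := M * ‖v‖) (fun s hs => by
        rw [uIoc_of_le hr0.le] at hs
        rw [smul_apply, norm_smul, Real.norm_of_nonneg (Real.exp_pos _).le]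
        have h2 : Real.exp (-(c * s)) ≤ 1 := by
          rw [Real.exp_le_one_iff]
          have := mul_nonneg hc0 hs.1.le
          linarith
        have h3 := (T s).le_of_opNorm_le (hb s ⟨by linarith [hs.1], by linarith [hs.2]⟩) v
        calc Real.exp (-(c * s)) * ‖T s v‖ ≤ 1 * (M * ‖v‖) := by gcongr
          _ = _ := one_mul _)
    rw [sub_zero, abs_of_pos hr0] at h1
    calc _ ≤ M * ‖v‖ * r := h1
      _ ≤ M * (2 * ‖f‖) * r := by gcongr
      _ = M * r * 2 * ‖f‖ := by ring
      _ ≤ ε * ‖f‖ := by gcongr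

end IsC0Group

end Groups

/-! ### Global flows of bounded Lipschitz vector fields -/

section ODE

variable {E : Type*} [NormedAddCommGroup E] [NormedSpace ℝ E]

/-- `Φ` is the global flow of the vector field `B`. -/
structure IsGlobalFlow (B : E → E) (Φ : ℝ → E → E) : Prop where
  apply_zero : ∀ x, Φ 0 x = x
  hasDerivAt : ∀ t x, HasDerivAt (fun s => Φ s x) (B (Φ t x)) t

theorem exists_globalFlow [CompleteSpace E] {B : E → E} {L M : ℝ≥0} (hL : LipschitzWith L B)
    (hM : ∀ x, ‖B x‖ ≤ M) : ∃ Φ, IsGlobalFlow B Φ := by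
  suffices h : ∀ x, ∃ γ : ℝ → E, γ 0 = x ∧ ∀ t, HasDerivAt γ (B (γ t)) t by
    choose γ h0 h1 using h
    exact ⟨fun t x => γ x t, h0, fun t x => h1 x t⟩
  intro x
  have hloc : ∀ n : ℕ, ∃ α : ℝ → E, α 0 = x ∧
      ∀ t ∈ Ioo (-((n : ℝ) + 1)) (n + 1), HasDerivAt α (B (α t)) t ∧ α t ∈ univ := fun n => by
    have hn : (0 : ℝ) ≤ n + 1 := by positivity
    -- At speed at most `M` a solution moves at most `M * (n + 1)` in time `n + 1`, so a ball of
    -- this radius imposes no restriction on the time interval.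
    have hpl : IsPicardLindelof (fun _ => B) (tmin := -((n : ℝ) + 1)) (tmax := n + 1)
        ⟨0, by constructor <;> linarith⟩ x (M * (n + 1)) 0 M L :=
      IsPicardLindelof.of_time_independent (fun y _ => hM y) hL.lipschitzOnWith (by simp)
    obtain ⟨α, h0, h1⟩ := hpl.exists_eq_forall_mem_Icc_hasDerivWithinAt₀
    exact ⟨α, h0, fun t ht => ⟨(h1 t (Ioo_subset_Icc_self ht)).hasDerivAt
      (Icc_mem_nhds ht.1 ht.2), mem_univ _⟩⟩
  choose α h0 h1 using hloc
  have hagree : ∀ m n : ℕ, m ≤ n → ∀ t ∈ Ioo (-((m : ℝ) + 1)) (m + 1), α m t = α n t := by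
    intro m n hmn
    have hmn' : (m : ℝ) ≤ n := by exact_mod_cast hmn
    have hm : (0 : ℝ) ≤ m := by positivity
    exact ODE_solution_unique_of_mem_Ioo (v := fun _ => B) (s := fun _ => univ) (t₀ := 0) (K := L)
      (fun t _ => hL.lipschitzOnWith) ⟨by linarith, by linarith⟩ (h1 m)
      (fun t ht => h1 n t ⟨by linarith [ht.1], by linarith [ht.2]⟩) (by rw [h0, h0])
  -- The solutions are glued by uniqueness; the one with index `⌊|t|⌋₊` is defined on an open
  -- interval containing `t`.
  refine ⟨fun t => α ⌊|t|⌋₊ t, by simp [h0], fun t => ?_⟩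
  have hmem : t ∈ Ioo (-((⌊|t|⌋₊ : ℝ) + 1)) (⌊|t|⌋₊ + 1) := abs_lt.1 (Nat.lt_floor_add_one |t|)
  refine (h1 ⌊|t|⌋₊ t hmem).1.congr_of_eventuallyEq ?_
  filter_upwards [Ioo_mem_nhds hmem.1 hmem.2] with s hs
  refine hagree _ _ ?_ s (abs_lt.1 (Nat.lt_floor_add_one |s|))
  have h2 := (Nat.floor_lt (abs_nonneg s)).2
    (show |s| < ((⌊|t|⌋₊ + 1 : ℕ) : ℝ) by push_cast; exact abs_lt.2 hs)
  omega

namespace IsGlobalFlow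

variable {B : E → E} {Φ : ℝ → E → E} {L M : ℝ≥0}

theorem neg (h : IsGlobalFlow B Φ) : IsGlobalFlow (-B) (fun t => Φ (-t)) where
  apply_zero x := by simp [h.apply_zero]
  hasDerivAt t x := by
    have h1 : HasDerivAt (fun s => Φ s x) (B (Φ (-t) x)) (0 - t) := by
      rw [zero_sub]; exact h.hasDerivAt _ x
    simpa using h1.comp_const_sub 0 t

theorem apply_add (h : IsGlobalFlow B Φ) (hL : LipschitzWith L B) (s t : ℝ) (x : E) :
    Φ (s + t) x = Φ s (Φ t x) := by
  have := ODE_solution_unique_univ (v := fun _ => B) (s := fun _ => univ) (t₀ := 0) (K := L)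
    (f := fun s => Φ (s + t) x) (g := fun s => Φ s (Φ t x)) (fun _ => hL.lipschitzOnWith)
    (fun s => ⟨(h.hasDerivAt (s + t) x).comp_add_const s t, mem_univ _⟩)
    (fun s => ⟨h.hasDerivAt s _, mem_univ _⟩) (by simp [h.apply_zero])
  exact congrFun this s

theorem apply_neg_apply (h : IsGlobalFlow B Φ) (hL : LipschitzWith L B) (t : ℝ) (x : E) :
    Φ (-t) (Φ t x) = x := by
  rw [← h.apply_add hL, neg_add_cancel, h.apply_zero]

theorem continuous_time (h : IsGlobalFlow B Φ) (x : E) : Continuous fun t => Φ t x :=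
  continuous_iff_continuousAt.2 fun t => (h.hasDerivAt t x).continuousAt

theorem dist_le_of_nonneg (h : IsGlobalFlow B Φ) (hL : LipschitzWith L B) {t : ℝ} (ht : 0 ≤ t)
    (x y : E) : dist (Φ t x) (Φ t y) ≤ dist x y * Real.exp (L * t) := by
  have := dist_le_of_trajectories_ODE (v := fun _ => B) (K := L) (a := 0) (b := t)
    (f := fun s => Φ s x) (g := fun s => Φ s y) (fun _ => hL) (h.continuous_time x).continuousOn
    (fun s _ => (h.hasDerivAt s x).hasDerivWithinAt) (h.continuous_time y).continuousOn
    (fun s _ => (h.hasDerivAt s y).hasDerivWithinAt) (δ := dist x y)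
    (by simp [h.apply_zero]) t ⟨ht, le_rfl⟩
  simpa using this

theorem lipschitzWith (h : IsGlobalFlow B Φ) (hL : LipschitzWith L B) (t : ℝ) :
    LipschitzWith (Real.exp (L * |t|)).toNNReal (Φ t) := by
  refine LipschitzWith.of_dist_le_mul fun x y => ?_
  rw [Real.coe_toNNReal _ (Real.exp_pos _).le, mul_comm]
  rcases le_total 0 t with ht | ht
  · rw [abs_of_nonneg ht]; exact h.dist_le_of_nonneg hL ht x y
  · have := h.neg.dist_le_of_nonneg hL.neg (neg_nonneg.2 ht) x y
    rw [abs_of_nonpos ht]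
    simpa using this

theorem norm_sub_le (h : IsGlobalFlow B Φ) (hM : ∀ x, ‖B x‖ ≤ M) (t : ℝ) (x : E) :
    ‖Φ t x - x‖ ≤ M * |t| := by
  have := Convex.norm_image_sub_le_of_norm_hasDerivWithin_le (s := univ) (f := fun t => Φ t x)
    (x := 0) (y := t) (fun s _ => (h.hasDerivAt s x).hasDerivWithinAt) (fun s _ => hM _)
    convex_univ (mem_univ _) (mem_univ _)
  simpa [h.apply_zero] using this

end IsGlobalFlow

end ODE

/-! ### Composition, multiplication and convergence in `L_2` -/

section LpTools

variable {α : Type*} [MeasurableSpace α] {μ : Measure α} {𝕜 : Type*} [RCLike 𝕜]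

theorem quasiMeasurePreserving_of_map_le {Ψ : α → α} (hΨ : Measurable Ψ) {c : ℝ≥0}
    (h : μ.map Ψ ≤ c • μ) : Measure.QuasiMeasurePreserving Ψ μ μ :=
  ⟨hΨ, (Measure.absolutelyContinuous_of_le h).trans (Measure.smul_absolutelyContinuous)⟩

theorem exists_compOp {Ψ : α → α} (hΨ : Measurable Ψ) {c : ℝ≥0} (h : μ.map Ψ ≤ c • μ) :
    ∃ T : Lp 𝕜 2 μ →L[𝕜] Lp 𝕜 2 μ, (∀ f, T f =ᵐ[μ] f ∘ Ψ) ∧ ‖T‖ ≤ (c : ℝ) ^ (1 / 2 : ℝ) := by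
  have hq := quasiMeasurePreserving_of_map_le hΨ h
  have hmem : ∀ f : Lp 𝕜 2 μ, MemLp (f ∘ Ψ) 2 μ := fun f => by
    have h1 : MemLp f 2 (μ.map Ψ) := (Lp.memLp f).of_measure_le_smul (c := c) (by simp) h
    exact h1.comp_of_map hΨ.aemeasurable
  let L : Lp 𝕜 2 μ →ₗ[𝕜] Lp 𝕜 2 μ :=
    { toFun := fun f => (hmem f).toLp
      map_add' := fun f g => by
        apply Lp.ext
        filter_upwards [(hmem (f + g)).coeFn_toLp, (hmem f).coeFn_toLp, (hmem g).coeFn_toLp,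
          Lp.coeFn_add (hmem f).toLp (hmem g).toLp, hq.ae (Lp.coeFn_add f g)] with x h1 h2 h3 h4 h5
        rw [h1, h4, Pi.add_apply, h2, h3]
        exact h5
      map_smul' := fun a f => by
        apply Lp.ext
        filter_upwards [(hmem (a • f)).coeFn_toLp, (hmem f).coeFn_toLp,
          Lp.coeFn_smul a (hmem f).toLp, hq.ae (Lp.coeFn_smul a f)] with x h1 h2 h3 h4
        simp only [RingHom.id_apply]
        rw [h1, h3, Pi.smul_apply, h2]
        exact h4 }
  refine ⟨L.mkContinuous ((c : ℝ) ^ (1 / 2 : ℝ)) fun f => ?_, fun f => (hmem f).coeFn_toLp,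
    LinearMap.mkContinuous_norm_le _ (by positivity) _⟩
  have h1 : eLpNorm (f ∘ Ψ) 2 μ ≤ (c : ℝ≥0∞) ^ (1 / 2 : ℝ) * eLpNorm f 2 μ := by
    rw [← eLpNorm_map_measure (((Lp.aestronglyMeasurable f).mono_ac hq.absolutelyContinuous))
      hΨ.aemeasurable]
    refine (eLpNorm_mono_measure _ h).trans ?_
    have := eLpNorm_smul_measure_of_ne_top (p := 2) (by simp) (f := f) (μ := μ) (c : ℝ≥0∞)
    refine le_of_eq (Eq.trans this ?_)
    simp
  change ‖(hmem f).toLp‖ ≤ _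
  rw [Lp.norm_toLp, Lp.norm_def]
  have h2 := ENNReal.toReal_mono (ENNReal.mul_ne_top (by simp) (Lp.eLpNorm_ne_top f)) h1
  rwa [ENNReal.toReal_mul, ← ENNReal.toReal_rpow, ENNReal.coe_toReal] at h2

theorem exists_mulOp {a : α → 𝕜} (ha : MemLp a ⊤ μ) :
    ∃ A : Lp 𝕜 2 μ →L[𝕜] Lp 𝕜 2 μ, ∀ f, A f =ᵐ[μ] fun x => a x * f x := by
  refine ⟨(ContinuousLinearMap.mul 𝕜 𝕜).holderL μ ⊤ 2 2 ha.toLp, fun f => ?_⟩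
  rw [ContinuousLinearMap.holderL_apply_apply]
  filter_upwards [(ContinuousLinearMap.mul 𝕜 𝕜).coeFn_holder (r := 2) ha.toLp f, ha.coeFn_toLp]
    with x h1 h2
  rw [h1, h2]; simp

theorem tendsto_Lp_two_of_dominated {ι : Type*} {l : Filter ι} [l.IsCountablyGenerated]
    {F : ι → Lp 𝕜 2 μ} {f : Lp 𝕜 2 μ} {u : ι → α → 𝕜} {v : α → 𝕜} (hF : ∀ᶠ i in l, F i =ᵐ[μ] u i)
    (hf : f =ᵐ[μ] v) {g : α → ℝ} (hg : MemLp g 2 μ)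
    (hb : ∀ᶠ i in l, ∀ᵐ x ∂μ, ‖u i x - v x‖ ≤ g x)
    (hlim : ∀ᵐ x ∂μ, Tendsto (fun i => u i x) l (𝓝 (v x))) : Tendsto F l (𝓝 f) := by
  rw [Lp.tendsto_Lp_iff_tendsto_eLpNorm']
  simp_rw [eLpNorm_eq_lintegral_rpow_enorm_toReal (p := 2) (by simp) (by simp)]
  have h0 : Tendsto (fun i => ∫⁻ x, ‖(⇑(F i) - ⇑f) x‖ₑ ^ (2 : ℝ≥0∞).toReal ∂μ) l
      (𝓝 (∫⁻ _, 0 ∂μ)) := by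
    have h1 : Tendsto (fun i => ∫⁻ x, ‖u i x - v x‖ₑ ^ (2 : ℝ≥0∞).toReal ∂μ) l
        (𝓝 (∫⁻ _, 0 ∂μ)) := by
      refine tendsto_lintegral_filter_of_dominated_convergence'
        (fun x => ‖g x‖ₑ ^ (2 : ℝ≥0∞).toReal) ?_ ?_ ?_ ?_
      · filter_upwards [hF] with i hi
        exact (((Lp.aestronglyMeasurable (F i)).congr hi).sub
          ((Lp.aestronglyMeasurable f).congr hf)).enorm.pow_const _
      · filter_upwards [hb] with i hi
        filter_upwards [hi] with x hx
        gcongr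
        exact enorm_le_iff_norm_le.2 (hx.trans (le_abs_self _))
      · exact (lintegral_rpow_enorm_lt_top_of_eLpNorm_lt_top (by simp) (by simp) hg.2).ne
      · filter_upwards [hlim] with x hx
        have h2 : Tendsto (fun i => u i x - v x) l (𝓝 0) := by
          simpa using hx.sub_const (v x)
        have h4 := (ENNReal.continuous_rpow_const (y := (2 : ℝ≥0∞).toReal)).continuousAt.tendsto.comp
          ((continuous_enorm.tendsto (0 : 𝕜)).comp h2)
        simpa [Function.comp_def] using h4
    refine h1.congr' ?_
    filter_upwards [hF] with i hi
    refine lintegral_congr_ae ?_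
    filter_upwards [hi, hf] with x h2 h3
    simp [h2, h3]
  have h5 := (ENNReal.continuous_rpow_const (y := 1 / (2 : ℝ≥0∞).toReal)).continuousAt.tendsto.comp h0
  simpa [Function.comp_def] using h5

theorem tendsto_Lp_two_of_bounded {ι : Type*} {l : Filter ι} [l.IsCountablyGenerated] [l.NeBot]
    {F : ι → Lp 𝕜 2 μ} {f : Lp 𝕜 2 μ} {u : ι → α → 𝕜} {v : α → 𝕜} (hF : ∀ᶠ i in l, F i =ᵐ[μ] u i)
    (hf : f =ᵐ[μ] v) {K : Set α} (hKm : MeasurableSet K) (hK : μ K ≠ ⊤) {C : ℝ}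
    (hb : ∀ᶠ i in l, ∀ x, ‖u i x‖ ≤ C)
    (h0 : ∀ᶠ i in l, ∀ x, x ∉ K → u i x = 0)
    (hlim : ∀ᵐ x ∂μ, Tendsto (fun i => u i x) l (𝓝 (v x))) : Tendsto F l (𝓝 f) := by
  refine tendsto_Lp_two_of_dominated hF hf (memLp_indicator_const 2 hKm (2 * C) (Or.inr hK)) ?_ hlim
  filter_upwards [h0, hb] with i hi hi'
  filter_upwards [hlim] with x hx
  by_cases hxK : x ∈ K
  · rw [indicator_of_mem hxK]
    have h1 : ‖v x‖ ≤ C := le_of_tendsto hx.norm (hb.mono fun i hi => hi x)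
    calc _ ≤ ‖u i x‖ + ‖v x‖ := norm_sub_le _ _
      _ ≤ C + C := add_le_add (hi' x) h1
      _ = 2 * C := by ring
  · rw [indicator_of_notMem hxK, hi x hxK]
    have h1 : v x = 0 := tendsto_nhds_unique hx
      (tendsto_const_nhds.congr' (by filter_upwards [h0] with i hi; rw [hi x hxK]))
    simp [h1]

end LpTools

/-! ### Distortion of volume by Lipschitz maps -/

section Volume

variable {d : ℕ}

/-- Volume is a multiple of the Hausdorff measure of full dimension, for which the bound holds
without any Jacobian. -/
theorem volume_image_le_of_lipschitz {K : ℝ≥0} {f : EuclideanSpace ℝ (Fin d) → EuclideanSpace ℝ (Fin d)}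
    (hf : LipschitzWith K f) (s : Set (EuclideanSpace ℝ (Fin d))) :
    volume (f '' s) ≤ ((K ^ d : ℝ≥0) : ℝ≥0∞) * volume s := by
  have hc := Measure.isAddLeftInvariant_eq_smul
    (volume : Measure (EuclideanSpace ℝ (Fin d)))
    (Measure.hausdorffMeasure (Module.finrank ℝ (EuclideanSpace ℝ (Fin d)) : ℝ))
  have h1 := hf.hausdorffMeasure_image_le
    (d := (Module.finrank ℝ (EuclideanSpace ℝ (Fin d)) : ℝ)) (by positivity) s
  rw [hc, Measure.smul_apply, Measure.smul_apply, ENNReal.smul_def, ENNReal.smul_def, smul_eq_mul,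
    smul_eq_mul, mul_left_comm]
  gcongr
  simpa using h1

theorem map_volume_le_of_lipschitz_inverse {K : ℝ≥0}
    {Ψ Θ : EuclideanSpace ℝ (Fin d) → EuclideanSpace ℝ (Fin d)} (hΨ : Measurable Ψ)
    (hΘ : LipschitzWith K Θ) (h : ∀ x, Θ (Ψ x) = x) :
    (volume : Measure (EuclideanSpace ℝ (Fin d))).map Ψ ≤ (K ^ d : ℝ≥0) • volume := by
  refine Measure.le_iff.2 fun s hs => ?_
  rw [Measure.map_apply hΨ hs]
  refine le_trans (measure_mono fun x hx => ?_) (volume_image_le_of_lipschitz hΘ s)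
  exact ⟨Ψ x, hx, h x⟩

end Volume

/-! ### Mollification -/

section Mollify

variable {d : ℕ} {F : Type*} [NormedAddCommGroup F] [NormedSpace ℝ F]

/-- A bump function supported in the ball of radius `2 / (n + 1)`. -/
def bump (d n : ℕ) : ContDiffBump (0 : EuclideanSpace ℝ (Fin d)) where
  rIn := 1 / ((n : ℝ) + 1)
  rOut := 2 / ((n : ℝ) + 1)
  rIn_pos := by positivity
  rIn_lt_rOut := by gcongr; norm_num

/-- Convolution with the normalised bump function `bump d n`. -/
def mollify (n : ℕ) (g : EuclideanSpace ℝ (Fin d) → F) : EuclideanSpace ℝ (Fin d) → F :=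
  (bump d n).normed volume ⋆[ContinuousLinearMap.lsmul ℝ ℝ, volume] g

theorem bump_rOut_le (n : ℕ) : (bump d n).rOut ≤ 2 := by
  have : (2 : ℝ) / ((n : ℝ) + 1) ≤ 2 / 1 := by gcongr; simp
  simpa [bump] using this

theorem tendsto_bump_rOut : Tendsto (fun n => (bump d n).rOut) atTop (𝓝 0) :=
  tendsto_const_div_atTop_nhds_zero_nat (2 : ℝ) |>.comp (tendsto_add_atTop_nat 1) |>.congr
    fun n => by simp [bump]

theorem contDiff_mollify [CompleteSpace F] (n : ℕ) {g : EuclideanSpace ℝ (Fin d) → F}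
    (hg : LocallyIntegrable g) : ContDiff ℝ ∞ (mollify n g) :=
  (bump d n).hasCompactSupport_normed.contDiff_convolution_left _ (bump d n).contDiff_normed hg

theorem ae_tendsto_mollify [CompleteSpace F] {g : EuclideanSpace ℝ (Fin d) → F}
    (hg : LocallyIntegrable g) : ∀ᵐ x, Tendsto (fun n => mollify n g x) atTop (𝓝 (g x)) :=
  ContDiffBump.ae_convolution_tendsto_right_of_locallyIntegrable (K := 2) tendsto_bump_rOut
    (Eventually.of_forall fun n => by simp [bump]; ring_nf; rfl) hg

theorem norm_mollify_le (n : ℕ) {g : EuclideanSpace ℝ (Fin d) → F} {C : ℝ}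
    (hg : ∀ᵐ x, ‖g x‖ ≤ C) (x : EuclideanSpace ℝ (Fin d)) : ‖mollify n g x‖ ≤ C := by
  have h1 : ∀ᵐ t, ‖(bump d n).normed volume t • g (x - t)‖ ≤ (bump d n).normed volume t * C := by
    filter_upwards [(quasiMeasurePreserving_sub_left volume x).ae hg] with t ht
    rw [norm_smul, Real.norm_of_nonneg ((bump d n).nonneg_normed t)]
    exact mul_le_mul_of_nonneg_left ht ((bump d n).nonneg_normed t)
  have h2 := norm_integral_le_of_norm_le ((bump d n).integrable_normed.mul_const C) h1
  rwa [integral_mul_const, (bump d n).integral_normed, one_mul] at h2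

theorem mollify_eq_zero (n : ℕ) {g : EuclideanSpace ℝ (Fin d) → F} {R : ℝ}
    (hg : ∀ x, R < ‖x‖ → g x = 0) {x : EuclideanSpace ℝ (Fin d)} (hx : R + 2 < ‖x‖) :
    mollify n g x = 0 := by
  refine integral_eq_zero_of_ae (Eventually.of_forall fun t => ?_)
  by_cases ht : ‖t‖ < (bump d n).rOut
  · have h1 : R < ‖x - t‖ := by
      have := norm_sub_norm_le x t
      linarith [bump_rOut_le (d := d) n]
    simp [hg _ h1]
  · have h1 : (bump d n).normed volume t = 0 := by
      rw [← Function.notMem_support, (bump d n).support_normed_eq]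
      simpa using ht
    simp [h1]

/-- The derivative falls on the bump function, and the reflected translate of the bump is a test
function for the weak derivative. -/
theorem partialDeriv_mollify_of_hasWeakPartial (n : ℕ) {j : Fin d}
    {u v : EuclideanSpace ℝ (Fin d) → ℝ} (hu : LocallyIntegrable u) (h : HasWeakPartial j u v)
    (x : EuclideanSpace ℝ (Fin d)) : partialDeriv j (mollify n u) x = mollify n v x := by
  set ρ := (bump d n).normed (volume : Measure (EuclideanSpace ℝ (Fin d))) with hρ
  have hρs : HasCompactSupport ρ := (bump d n).hasCompactSupport_normed
  have hρc : ContDiff ℝ ∞ ρ := (bump d n).contDiff_normed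
  have hρc1 : ContDiff ℝ 1 ρ := (bump d n).contDiff_normed (n := 1)
  have h1 := hρs.hasFDerivAt_convolution_left (ContinuousLinearMap.lsmul ℝ ℝ) hρc1 hu x
  have h2 : partialDeriv j (mollify n u) x =
      (fderiv ℝ ρ ⋆[(ContinuousLinearMap.lsmul ℝ ℝ).precompL (EuclideanSpace ℝ (Fin d)), volume] u) x
        (EuclideanSpace.single j 1) := by
    rw [partialDeriv, mollify, h1.fderiv]
  have hex := (hρs.fderiv ℝ).convolutionExists_left
    ((ContinuousLinearMap.lsmul ℝ ℝ).precompL (EuclideanSpace ℝ (Fin d)))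
    (hρc1.continuous_fderiv (by simp)) hu x
  rw [h2, convolution_eq_swap, ContinuousLinearMap.integral_apply
    ((convolutionExistsAt_iff_integrable_swap).1 hex)]
  have htest : IsTestFunction fun t => ρ (x - t) := by
    refine ⟨hρc.comp (contDiff_const.sub contDiff_id), ?_⟩
    exact hρs.comp_homeomorph (Homeomorph.subLeft x)
  have h3 := h _ htest
  have h4 : ∀ t, partialDeriv j (fun t => ρ (x - t)) t =
      -fderiv ℝ ρ (x - t) (EuclideanSpace.single j 1) := fun t => by
    have h5 : HasFDerivAt (fun t => ρ (x - t)) (-(fderiv ℝ ρ (x - t))) t := by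
      have h6 := (hρc1.differentiable (by simp) (x - t)).hasFDerivAt
      have h7 : HasFDerivAt (fun t => x - t) (-ContinuousLinearMap.id ℝ _) t :=
        (hasFDerivAt_id t).const_sub x
      exact (h6.comp t h7).congr_fderiv (by ext; simp)
    rw [partialDeriv, h5.fderiv]; rfl
  rw [mollify, convolution_eq_swap]
  simp only [h4, mul_neg, integral_neg, neg_inj] at h3
  simp only [ContinuousLinearMap.precompL_apply, ContinuousLinearMap.lsmul_apply, smul_eq_mul]
  simpa [mul_comm] using h3

end Mollify

/-! ### Lipschitz representatives of `W^{1,∞}` functions -/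

section Sobolev

variable {d : ℕ}

theorem exists_ae_bound_of_memLp_top {α : Type*} [MeasurableSpace α] {μ : Measure α} {F : Type*}
    [NormedAddCommGroup F] {u : α → F} (h : MemLp u ⊤ μ) : ∃ M : ℝ≥0, ∀ᵐ x ∂μ, ‖u x‖ ≤ M := by
  refine ⟨(eLpNorm u ⊤ μ).toNNReal, ?_⟩
  have h1 := ae_le_eLpNormEssSup (f := u) (μ := μ)
  filter_upwards [h1] with x hx
  rw [← eLpNorm_exponent_top, ← ENNReal.coe_toNNReal h.2.ne] at hx
  rw [← coe_nnnorm]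
  exact_mod_cast hx

theorem norm_apply_le_of_partial {F : Type*} [NormedAddCommGroup F] [NormedSpace ℝ F]
    (A : EuclideanSpace ℝ (Fin d) →L[ℝ] F) {C : Fin d → ℝ≥0}
    (hC : ∀ j, ‖A (EuclideanSpace.single j 1)‖ ≤ C j) : ‖A‖₊ ≤ ∑ j, C j := by
  rw [← NNReal.coe_le_coe, coe_nnnorm, NNReal.coe_sum]
  refine A.opNorm_le_bound (by positivity) fun w => ?_
  have h1 : w = ∑ j, w j • EuclideanSpace.single j (1 : ℝ) := by
    ext k
    simp [Pi.single_apply]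
  calc ‖A w‖ = ‖∑ j, w j • A (EuclideanSpace.single j 1)‖ := by
        conv_lhs => rw [h1]
        simp only [map_sum, map_smul]
    _ ≤ ∑ j, ‖w‖ * C j := norm_sum_le_of_le _ fun j _ => by
        rw [norm_smul]
        exact mul_le_mul (PiLp.norm_apply_le w j) (hC j) (norm_nonneg _) (norm_nonneg _)
    _ = _ := by rw [← Finset.mul_sum, mul_comm]

/-- The mollifications are Lipschitz with a common constant and converge almost everywhere, so `u`
is Lipschitz on a set of full measure. It is extended from there, and truncated at `±M` to keep the
extension bounded. -/
theorem MemW1Inf.exists_lipschitz {u : EuclideanSpace ℝ (Fin d) → ℝ} (h : MemW1Inf u) :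
    ∃ (v : EuclideanSpace ℝ (Fin d) → ℝ) (L M : ℝ≥0), u =ᵐ[volume] v ∧ LipschitzWith L v ∧
      ∀ x, ‖v x‖ ≤ M := by
  obtain ⟨M, hM⟩ := exists_ae_bound_of_memLp_top h.1
  choose w hw hwu using h.2
  choose C hC using fun j => exists_ae_bound_of_memLp_top (hw j)
  have hu := h.1.locallyIntegrable le_top
  have hLip : ∀ n, LipschitzWith (∑ j, C j) (mollify n u) := fun n => by
    refine lipschitzWith_of_nnnorm_fderiv_le
      ((contDiff_mollify n hu).differentiable (by simp)) fun x => ?_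
    refine norm_apply_le_of_partial _ fun j => ?_
    have := partialDeriv_mollify_of_hasWeakPartial n hu (hwu j) x
    rw [partialDeriv] at this
    rw [this]
    exact norm_mollify_le n (hC j) x
  let S := {x | Tendsto (fun n => mollify n u x) atTop (𝓝 (u x)) ∧ ‖u x‖ ≤ M}
  have hS : ∀ᵐ x, x ∈ S := (ae_tendsto_mollify hu).and hM
  have hSL : LipschitzOnWith (∑ j, C j) u S := LipschitzOnWith.of_dist_le_mul fun x hx y hy =>
    le_of_tendsto (hx.1.dist hy.1) (Eventually.of_forall fun n => (hLip n).dist_le_mul x y)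
  obtain ⟨g, hg, hgu⟩ := hSL.extend_real
  refine ⟨fun x => max (min (g x) M) (-M), _, M, ?_, (hg.min_const M).max_const (-M), fun x => ?_⟩
  · filter_upwards [hS] with x hx
    have h1 := abs_le.1 hx.2
    rw [← hgu hx, min_eq_left h1.2, max_eq_left h1.1]
  · rw [Real.norm_eq_abs, abs_le]
    have hM0 : -(M : ℝ) ≤ M := by have := M.2; linarith
    exact ⟨le_max_right _ _, max_le (min_le_right _ _) hM0⟩

end Sobolev

/-! ### Test functions and the closure of a vector field -/

section TestFunctions

variable {d : ℕ} {F G : Type*} [NormedAddCommGroup F] [NormedSpace ℝ F] [NormedAddCommGroup G]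
  [NormedSpace ℝ G] {𝕜 : Type*} [RCLike 𝕜]

theorem norm_partialDeriv_le {f : EuclideanSpace ℝ (Fin d) → F} {K : ℝ≥0} (hf : LipschitzWith K f)
    (j : Fin d) (x : EuclideanSpace ℝ (Fin d)) : ‖partialDeriv j f x‖ ≤ K := by
  have h1 := (fderiv ℝ f x).le_of_opNorm_le (norm_fderiv_le_of_lipschitz ℝ hf)
    (EuclideanSpace.single j (1 : ℝ))
  simpa [partialDeriv] using h1

theorem stronglyMeasurable_partialDeriv [FiniteDimensional ℝ F] (f : EuclideanSpace ℝ (Fin d) → F)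
    (j : Fin d) : StronglyMeasurable (partialDeriv j f) := by
  have := FiniteDimensional.complete ℝ F
  have := FiniteDimensional.proper ℝ F
  borelize F
  exact (measurable_fderiv_apply_const ℝ f _).stronglyMeasurable

theorem fderiv_apply_eq_sum (f : EuclideanSpace ℝ (Fin d) → F) (x w : EuclideanSpace ℝ (Fin d)) :
    fderiv ℝ f x w = ∑ j, w j • partialDeriv j f x := by
  have h1 : w = ∑ j, w j • EuclideanSpace.single j (1 : ℝ) := by
    ext k
    simp [Pi.single_apply]
  conv_lhs => rw [h1]
  simp only [map_sum, map_smul, partialDeriv]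

theorem locallyIntegrable_partialDeriv [FiniteDimensional ℝ F] {f : EuclideanSpace ℝ (Fin d) → F}
    {K : ℝ≥0} (hf : LipschitzWith K f) (j : Fin d) : LocallyIntegrable (partialDeriv j f) :=
  (memLp_top_of_bound (stronglyMeasurable_partialDeriv f j).aestronglyMeasurable K
    (Eventually.of_forall (norm_partialDeriv_le hf j))).locallyIntegrable le_top

/-- Here the derivative falls on `f`: Rademacher's theorem gives it almost everywhere, and the
Lipschitz constant dominates the difference quotients. -/
theorem partialDeriv_mollify_of_lipschitz [FiniteDimensional ℝ F] (n : ℕ)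
    {f : EuclideanSpace ℝ (Fin d) → F} {K : ℝ≥0} (hf : LipschitzWith K f) (j : Fin d)
    (x : EuclideanSpace ℝ (Fin d)) :
    partialDeriv j (mollify n f) x = mollify n (partialDeriv j f) x := by
  have := FiniteDimensional.complete ℝ F
  set ρ := (bump d n).normed (volume : Measure (EuclideanSpace ℝ (Fin d))) with hρ
  have hρs : HasCompactSupport ρ := (bump d n).hasCompactSupport_normed
  have hρc : Continuous ρ := (bump d n).continuous_normed
  have hρi : Integrable ρ := (bump d n).integrable_normed
  have hρ0 : ∀ t, 0 ≤ ρ t := (bump d n).nonneg_normed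
  set e := EuclideanSpace.single j (1 : ℝ) with he
  have hcurve : ∀ s, HasDerivAt (fun s : ℝ => x + s • e) e s := fun s => by
    simpa using ((hasDerivAt_id s).smul_const e).const_add x
  have h1 : HasDerivAt (fun s : ℝ => mollify n f (x + s • e)) (partialDeriv j (mollify n f) x) 0 := by
    have h2 := (((contDiff_mollify n hf.continuous.locallyIntegrable).differentiable
      (by simp)) (x + (0 : ℝ) • e)).hasFDerivAt.comp_hasDerivAt 0 (hcurve 0)
    simpa [Function.comp_def, partialDeriv] using h2
  have h3 : HasDerivAt (fun s : ℝ => mollify n f (x + s • e)) (mollify n (partialDeriv j f) x) 0 := by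
    refine (hasDerivAt_integral_of_dominated_loc_of_lip (s := univ)
      (F := fun s t => ρ t • f (x + s • e - t)) (F' := fun t => ρ t • partialDeriv j f (x - t))
      (bound := fun t => ρ t * K) univ_mem ?_ ?_ ?_ ?_ (hρi.mul_const _) ?_).2
    · refine Eventually.of_forall fun s => Continuous.aestronglyMeasurable ?_
      have := hf.continuous
      fun_prop
    · refine Continuous.integrable_of_hasCompactSupport ?_ ?_
      · have := hf.continuous
        fun_prop
      · exact hρs.smul_right
    · refine hρc.aestronglyMeasurable.smul (StronglyMeasurable.aestronglyMeasurable ?_)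
      exact (stronglyMeasurable_partialDeriv f j).comp_measurable (measurable_const.sub measurable_id)
    · refine Eventually.of_forall fun t => LipschitzOnWith.of_dist_le_mul fun s _ r _ => ?_
      rw [dist_smul₀, Real.coe_nnabs, abs_of_nonneg (mul_nonneg (hρ0 t) K.coe_nonneg), mul_assoc,
        Real.norm_of_nonneg (hρ0 t)]
      refine mul_le_mul_of_nonneg_left ?_ (hρ0 t)
      refine (hf.dist_le_mul _ _).trans (le_of_eq ?_)
      congr 1
      rw [dist_sub_right, dist_add_left, dist_eq_norm, ← sub_smul, norm_smul, he,
        PiLp.norm_single, norm_one, mul_one, dist_eq_norm]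
    · filter_upwards [(quasiMeasurePreserving_sub_left volume x).ae hf.ae_differentiableAt] with t ht
      have h4 : HasDerivAt (fun s : ℝ => x + s • e - t) e 0 := (hcurve 0).sub_const t
      have h5 : HasFDerivAt f (fderiv ℝ f (x - t)) (x + (0 : ℝ) • e - t) := by
        simpa using ht.hasFDerivAt
      exact (h5.comp_hasDerivAt 0 h4).const_smul (ρ t)
  exact h1.unique h3

namespace IsTestFunction

variable {φ χ : EuclideanSpace ℝ (Fin d) → F}

theorem differentiable (hφ : IsTestFunction φ) : Differentiable ℝ φ :=
  hφ.1.differentiable (by simp)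

theorem continuous (hφ : IsTestFunction φ) : Continuous φ := hφ.1.continuous

theorem memLp (hφ : IsTestFunction φ) (p : ℝ≥0∞) : MemLp φ p :=
  hφ.continuous.memLp_of_hasCompactSupport hφ.2

theorem partialDeriv (hφ : IsTestFunction φ) (j : Fin d) :
    IsTestFunction (partialDeriv j φ) :=
  ⟨(hφ.1.fderiv_right (m := ∞) (by simp)).clm_apply contDiff_const, hφ.2.fderiv_apply ℝ _⟩

theorem add (hφ : IsTestFunction φ) (hχ : IsTestFunction χ) : IsTestFunction (fun x => φ x + χ x) :=
  ⟨hφ.1.add hχ.1, hφ.2.add hχ.2⟩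

theorem clm_comp (A : F →L[ℝ] G) (hφ : IsTestFunction φ) : IsTestFunction (fun x => A (φ x)) :=
  ⟨A.contDiff.comp hφ.1, hφ.2.comp_left (map_zero A)⟩

theorem const_smul (c : ℝ) (hφ : IsTestFunction φ) : IsTestFunction (fun x => c • φ x) :=
  ⟨hφ.1.const_smul c, hφ.2.comp_left (g := fun y => c • y) (smul_zero c)⟩

theorem smul {ψ : EuclideanSpace ℝ (Fin d) → ℝ} (hψ : ContDiff ℝ ∞ ψ) (hφ : IsTestFunction φ) :
    IsTestFunction (fun x => ψ x • φ x) :=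
  ⟨hψ.smul hφ.1, hφ.2.smul_left⟩

theorem mul {φ χ : EuclideanSpace ℝ (Fin d) → 𝕜} (hφ : IsTestFunction φ) (hχ : IsTestFunction χ) :
    IsTestFunction (fun x => φ x * χ x) :=
  ⟨hφ.1.mul hχ.1, hφ.2.mul_right⟩

theorem exists_lipschitz (hφ : IsTestFunction φ) : ∃ K, LipschitzWith K φ :=
  hφ.1.lipschitzWith_of_hasCompactSupport hφ.2 (by simp)

end IsTestFunction

theorem partialDeriv_add {φ χ : EuclideanSpace ℝ (Fin d) → F} (hφ : IsTestFunction φ)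
    (hχ : IsTestFunction χ) (j : Fin d) (x : EuclideanSpace ℝ (Fin d)) :
    partialDeriv j (fun x => φ x + χ x) x = partialDeriv j φ x + partialDeriv j χ x := by
  simp [partialDeriv, fderiv_fun_add (hφ.differentiable x) (hχ.differentiable x)]

theorem partialDeriv_clm_comp {φ : EuclideanSpace ℝ (Fin d) → F} (A : F →L[ℝ] G)
    (hφ : IsTestFunction φ) (j : Fin d) (x : EuclideanSpace ℝ (Fin d)) :
    partialDeriv j (fun x => A (φ x)) x = A (partialDeriv j φ x) := by
  have := (A.hasFDerivAt.comp x (hφ.differentiable x).hasFDerivAt).fderiv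
  simp only [partialDeriv]
  change fderiv ℝ (A ∘ φ) x _ = _
  rw [this]; rfl

theorem partialDeriv_smul {ψ : EuclideanSpace ℝ (Fin d) → ℝ} {φ : EuclideanSpace ℝ (Fin d) → F}
    (hψ : Differentiable ℝ ψ) (hφ : Differentiable ℝ φ) (j : Fin d)
    (x : EuclideanSpace ℝ (Fin d)) : partialDeriv j (fun x => ψ x • φ x) x =
      ψ x • partialDeriv j φ x + partialDeriv j ψ x • φ x := by
  simp only [partialDeriv]
  rw [fderiv_fun_smul (hψ x) (hφ x)]
  simp

theorem partialDeriv_mul {φ χ : EuclideanSpace ℝ (Fin d) → 𝕜} (hφ : Differentiable ℝ φ)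
    (hχ : Differentiable ℝ χ) (j : Fin d) (x : EuclideanSpace ℝ (Fin d)) :
    partialDeriv j (fun x => φ x * χ x) x =
      φ x * partialDeriv j χ x + partialDeriv j φ x * χ x := by
  simp only [partialDeriv]
  rw [fderiv_fun_mul (hφ x) (hχ x)]
  simp [mul_comm]

theorem vectorField_eq_fderiv (B : EuclideanSpace ℝ (Fin d) → EuclideanSpace ℝ (Fin d))
    (φ : EuclideanSpace ℝ (Fin d) → 𝕜) (x : EuclideanSpace ℝ (Fin d)) :
    vectorField (fun j x => B x j) φ x = fderiv ℝ φ x (B x) := by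
  rw [fderiv_apply_eq_sum, vectorField]

theorem vectorField_mul (b : Fin d → EuclideanSpace ℝ (Fin d) → ℝ)
    {φ χ : EuclideanSpace ℝ (Fin d) → 𝕜} (hφ : Differentiable ℝ φ)
    (hχ : Differentiable ℝ χ) (x : EuclideanSpace ℝ (Fin d)) :
    vectorField b (fun x => φ x * χ x) x = φ x * vectorField b χ x + vectorField b φ x * χ x := by
  simp only [vectorField, partialDeriv_mul hφ hχ, smul_add, Finset.sum_add_distrib,
    Finset.mul_sum, Finset.sum_mul, mul_smul_comm, smul_mul_assoc]

theorem memLp_vectorField {b : Fin d → EuclideanSpace ℝ (Fin d) → ℝ} (hb : ∀ j, MemLp (b j) ⊤)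
    {φ : EuclideanSpace ℝ (Fin d) → 𝕜} (hφ : IsTestFunction φ) (p : ℝ≥0∞) :
    MemLp (vectorField b φ) p :=
  memLp_finsetSum _ fun j _ => ((hφ.partialDeriv j).memLp p).smul (hb j)

/-- The graph of `∑_j b_j ∂_j` on test functions, as a real subspace. -/
def graphSubmodule (𝕜 : Type*) [RCLike 𝕜] (b : Fin d → EuclideanSpace ℝ (Fin d) → ℝ) :
    Submodule ℝ (L2 𝕜 d × L2 𝕜 d) where
  carrier := vectorFieldGraph 𝕜 b
  add_mem' := by
    rintro p q ⟨φ, hφ, h1, h2⟩ ⟨χ, hχ, h3, h4⟩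
    refine ⟨fun x => φ x + χ x, hφ.add hχ, ?_, ?_⟩
    · filter_upwards [Lp.coeFn_add p.1 q.1, h1, h3] with x e1 e2 e3
      rw [Prod.fst_add, e1, Pi.add_apply, e2, e3]
    · filter_upwards [Lp.coeFn_add p.2 q.2, h2, h4] with x e1 e2 e3
      rw [Prod.snd_add, e1, Pi.add_apply, e2, e3]
      simp only [vectorField, partialDeriv_add hφ hχ, smul_add, Finset.sum_add_distrib]
  zero_mem' := by
    refine ⟨0, ⟨contDiff_const, HasCompactSupport.zero⟩, Lp.coeFn_zero _ _ _, ?_⟩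
    filter_upwards [Lp.coeFn_zero 𝕜 2 (volume : Measure (EuclideanSpace ℝ (Fin d)))] with x hx
    rw [Prod.snd_zero, hx]
    simp [vectorField, partialDeriv]
  smul_mem' := by
    rintro c p ⟨φ, hφ, h1, h2⟩
    refine ⟨fun x => c • φ x, hφ.const_smul c, ?_, ?_⟩
    · filter_upwards [Lp.coeFn_smul c p.1, h1] with x e1 e2
      rw [Prod.smul_fst, e1, Pi.smul_apply, e2]
    · filter_upwards [Lp.coeFn_smul c p.2, h2] with x e1 e2
      rw [Prod.smul_snd, e1, Pi.smul_apply, e2]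
      have h3 := partialDeriv_clm_comp (c • ContinuousLinearMap.id ℝ 𝕜) hφ
      simp only [smul_apply, ContinuousLinearMap.id_apply] at h3
      simp only [vectorField, h3, Finset.smul_sum]
      exact Finset.sum_congr rfl fun j _ => smul_comm _ _ _

theorem vectorFieldGraph_congr {b b' : Fin d → EuclideanSpace ℝ (Fin d) → ℝ}
    (h : ∀ j, b j =ᵐ[volume] b' j) : vectorFieldGraph 𝕜 b = vectorFieldGraph 𝕜 b' := by
  ext p
  refine exists_congr fun φ => and_congr_right fun _ => and_congr_right fun _ => ?_
  have h1 : vectorField b φ =ᵐ[volume] vectorField b' φ := by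
    filter_upwards [ae_all_iff.2 h] with x hx
    simp [vectorField, hx]
  exact ⟨fun h2 => h2.trans h1, fun h2 => h2.trans h1.symm⟩

/-- The flow of a Lipschitz field need not preserve smoothness, but it does preserve this larger
class. Mollifications of `f` and their gradients are uniformly bounded, supported in a common ball,
and converge almost everywhere, so both components converge in `L_2`. -/
theorem mem_closure_graph_of_lipschitz {b : Fin d → EuclideanSpace ℝ (Fin d) → ℝ}
    (hbm : ∀ j, MemLp (b j) ⊤) {M : Fin d → ℝ≥0} (hb : ∀ j x, ‖b j x‖ ≤ M j)
    {f : EuclideanSpace ℝ (Fin d) → 𝕜} {K : ℝ≥0} (hf : LipschitzWith K f)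
    (hfs : HasCompactSupport f) {u : L2 𝕜 d} (hu : u =ᵐ[volume] f) :
    ∃ g, (u, g) ∈ closure (vectorFieldGraph 𝕜 b) := by
  obtain ⟨C, hC⟩ := hf.continuous.bounded_above_of_compact_support hfs
  obtain ⟨R, hR⟩ := hfs.isCompact.isBounded.exists_norm_le
  have h0 : ∀ x, R < ‖x‖ → f x = 0 := fun x hx => by
    by_contra h
    exact absurd (hR x (subset_tsupport f h)) (not_le.2 hx)
  have h0' : ∀ j x, R < ‖x‖ → partialDeriv j f x = 0 := fun j x hx => by
    have : x ∉ tsupport f := fun h => absurd (hR x h) (not_le.2 hx)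
    rw [partialDeriv, image_eq_zero_of_notMem_tsupport
      (fun h => this (tsupport_fderiv_subset ℝ h))]
    rfl
  have htest : ∀ n, IsTestFunction (mollify n f) := fun n =>
    ⟨contDiff_mollify n hf.continuous.locallyIntegrable,
      (bump d n).hasCompactSupport_normed.convolution _ hfs⟩
  have hvm : MemLp (vectorField b f) 2 := by
    refine memLp_finsetSum _ fun j _ => MemLp.smul (φ := b j) (f := partialDeriv j f) (p := ⊤)
      (q := 2) ?_ (hbm j)
    refine (memLp_indicator_const (s := Metric.closedBall 0 R) 2
      Metric.isClosed_closedBall.measurableSet (K : ℝ)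
      (Or.inr measure_closedBall_lt_top.ne)).mono
      (stronglyMeasurable_partialDeriv f j).aestronglyMeasurable (Eventually.of_forall fun x => ?_)
    by_cases hx : x ∈ Metric.closedBall 0 R
    · rw [indicator_of_mem hx]
      simpa using norm_partialDeriv_le hf j x
    · rw [h0' j x (by simpa using hx)]
      simp
  refine ⟨hvm.toLp, mem_closure_of_tendsto (f := fun n => (((htest n).memLp 2).toLp,
    (memLp_vectorField hbm (htest n) 2).toLp)) (b := atTop) ?_ (Eventually.of_forall fun n =>
      ⟨mollify n f, htest n, ((htest n).memLp 2).coeFn_toLp,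
        (memLp_vectorField hbm (htest n) 2).coeFn_toLp⟩)⟩
  refine Tendsto.prodMk_nhds ?_ ?_
  · refine tendsto_Lp_two_of_bounded (Eventually.of_forall fun n => MemLp.coeFn_toLp _) hu
      (K := Metric.closedBall 0 (R + 2)) Metric.isClosed_closedBall.measurableSet
      measure_closedBall_lt_top.ne (C := C) (Eventually.of_forall fun n =>
        norm_mollify_le n (Eventually.of_forall hC))
      (Eventually.of_forall fun n x hx => mollify_eq_zero n h0 (by simpa using hx))
      (ae_tendsto_mollify hf.continuous.locallyIntegrable)
  · refine tendsto_Lp_two_of_bounded (Eventually.of_forall fun n => MemLp.coeFn_toLp _)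
      hvm.coeFn_toLp
      (K := Metric.closedBall 0 (R + 2)) Metric.isClosed_closedBall.measurableSet
      measure_closedBall_lt_top.ne (C := ∑ j, M j * K) (Eventually.of_forall fun n x => ?_)
      (Eventually.of_forall fun n x hx => ?_) ?_
    · refine norm_sum_le_of_le _ fun j _ => ?_
      rw [norm_smul, partialDeriv_mollify_of_lipschitz n hf]
      exact mul_le_mul (hb j x) (norm_mollify_le n (Eventually.of_forall (norm_partialDeriv_le hf j)) x)
        (norm_nonneg _) (M j).2
    · refine Finset.sum_eq_zero fun j _ => ?_
      rw [partialDeriv_mollify_of_lipschitz n hf, mollify_eq_zero n (h0' j) (by simpa using hx),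
        smul_zero]
    · filter_upwards [ae_all_iff.2 fun j =>
        ae_tendsto_mollify (locallyIntegrable_partialDeriv hf j)] with x hx
      refine tendsto_finsetSum _ fun j _ => ?_
      simp_rw [partialDeriv_mollify_of_lipschitz _ hf]
      exact (hx j).const_smul _

end TestFunctions

/-! ### Existence and uniqueness of the group of a vector field -/

section Existence

variable {d : ℕ} {𝕜 : Type*} [RCLike 𝕜]

/-- A one-parameter group that is bounded near zero and strongly continuous at zero on a dense set
is strongly continuous. -/
theorem isC0Group_of_dense {X : Type*} [NormedAddCommGroup X] [NormedSpace 𝕜 X]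
    {T : ℝ → X →L[𝕜] X} (h0 : T 0 = ContinuousLinearMap.id 𝕜 X)
    (hadd : ∀ s t, T (s + t) = (T s).comp (T t)) {C : ℝ} (hC : ∀ᶠ t in 𝓝 0, ‖T t‖ ≤ C)
    {D : Set X} (hD : Dense D) (hcont : ∀ f ∈ D, Tendsto (fun t => T t f) (𝓝 0) (𝓝 f)) :
    IsC0Group T where
  map_zero := h0
  map_add := hadd
  continuous f := by
    have hz : Tendsto (fun t => T t f) (𝓝 0) (𝓝 f) := by
      rw [Metric.tendsto_nhds]
      intro ε hε
      set C' := max C 0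
      have hC' : 0 < C' + 1 := by positivity
      obtain ⟨g, hg, hfg⟩ := hD.exists_dist_lt f (show 0 < ε / (2 * (C' + 1)) by positivity)
      filter_upwards [hC, (Metric.tendsto_nhds.1 (hcont g hg)) (ε / 2) (by positivity)] with t h1 h2
      have h3 : dist (T t f) (T t g) ≤ C' * dist f g := by
        rw [dist_eq_norm, ← map_sub, dist_eq_norm]
        exact (T t).le_of_opNorm_le (h1.trans (le_max_left _ _)) _
      calc dist (T t f) f ≤ dist (T t f) (T t g) + dist (T t g) g + dist g f := dist_triangle4 _ _ _ _
        _ ≤ C' * dist f g + dist (T t g) g + dist f g := by rw [dist_comm g f]; gcongr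
        _ = dist f g * (C' + 1) + dist (T t g) g := by ring
        _ < ε / (2 * (C' + 1)) * (C' + 1) + ε / 2 := by gcongr
        _ = ε := by field_simp; ring
    refine continuous_iff_continuousAt.2 fun t => ?_
    have h4 : Tendsto (fun s => T t (T (s - t) f)) (𝓝 t) (𝓝 (T t f)) := by
      have h5 : Tendsto (fun s => s - t) (𝓝 t) (𝓝 0) := by
        have : Continuous fun s => s - t := by fun_prop
        simpa using this.tendsto t
      exact ((T t).continuous.tendsto f).comp (hz.comp h5)
    refine h4.congr fun s => ?_
    rw [← ContinuousLinearMap.comp_apply, ← hadd]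
    simp

theorem dense_testFunctions : Dense {f : L2 𝕜 d | ∃ φ, IsTestFunction φ ∧ f =ᵐ[volume] φ} := by
  refine (Lp.dense_hasCompactSupport_contDiff (F := 𝕜) (p := 2)
    (μ := (volume : Measure (EuclideanSpace ℝ (Fin d)))) (by simp)).mono ?_
  rintro f ⟨g, h1, h2, h3⟩
  exact ⟨g, ⟨h3, h2⟩, h1⟩

variable {B : EuclideanSpace ℝ (Fin d) → EuclideanSpace ℝ (Fin d)} {L M : ℝ≥0}
  {Φ : ℝ → EuclideanSpace ℝ (Fin d) → EuclideanSpace ℝ (Fin d)}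

theorem IsGlobalFlow.apply_eq_zero_of_large {F : Type*} [Zero F] (hΦ : IsGlobalFlow B Φ)
    (hM : ∀ x, ‖B x‖ ≤ M) {φ : EuclideanSpace ℝ (Fin d) → F} {R : ℝ}
    (hφ : ∀ x, R < ‖x‖ → φ x = 0) {t : ℝ} {x : EuclideanSpace ℝ (Fin d)}
    (hx : R + M * |t| < ‖x‖) : φ (Φ t x) = 0 := by
  refine hφ _ ?_
  have h1 := hΦ.norm_sub_le hM t x
  have h2 := norm_sub_norm_le x (Φ t x)
  rw [norm_sub_rev] at h2
  linarith

theorem exists_radius {F : Type*} [NormedAddCommGroup F] {φ : EuclideanSpace ℝ (Fin d) → F}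
    (hφ : HasCompactSupport φ) : ∃ R : ℝ, ∀ x, R < ‖x‖ → φ x = 0 := by
  obtain ⟨R, hR⟩ := hφ.isCompact.isBounded.exists_norm_le
  refine ⟨R, fun x hx => ?_⟩
  by_contra h
  exact absurd (hR x (subset_tsupport φ h)) (not_le.2 hx)

/-- The group is `T t f = f ∘ Φ t`. It is bounded on `L_2` because `Φ t` has the Lipschitz inverse
`Φ (-t)`, and composition visibly preserves products that vanish almost everywhere. -/
theorem IsGlobalFlow.exists_isFlow (hΦ : IsGlobalFlow B Φ) (hL : LipschitzWith L B)
    (hM : ∀ x, ‖B x‖ ≤ M) : ∃ T : ℝ → L2 𝕜 d →L[𝕜] L2 𝕜 d, IsFlow (fun j x => B x j) T ∧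
      ∀ t f g, (∀ᵐ x, f x * g x = 0) → ∀ᵐ x, T t f x * T t g x = 0 := by
  have hmeas : ∀ t, Measurable (Φ t) := fun t => (hΦ.lipschitzWith hL t).continuous.measurable
  have hmap : ∀ t, (volume : Measure (EuclideanSpace ℝ (Fin d))).map (Φ t) ≤
      ((Real.exp (L * |t|)).toNNReal ^ d : ℝ≥0) • volume := fun t => by
    have h1 := hΦ.lipschitzWith hL (-t)
    rw [abs_neg] at h1
    exact map_volume_le_of_lipschitz_inverse (hmeas t) h1 (hΦ.apply_neg_apply hL t)
  have hq := fun t => quasiMeasurePreserving_of_map_le (hmeas t) (hmap t)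
  choose T hT hTn using fun t => exists_compOp (𝕜 := 𝕜) (hmeas t) (hmap t)
  have hbm : ∀ j, MemLp (fun x => B x j) ⊤ (volume : Measure (EuclideanSpace ℝ (Fin d))) := fun j => by
    have hc : Continuous fun x => B x j := by
      have := hL.continuous
      fun_prop
    exact memLp_top_of_bound hc.aestronglyMeasurable M
      (Eventually.of_forall fun x => (PiLp.norm_apply_le (B x) j).trans (hM x))
  have h0 : T 0 = ContinuousLinearMap.id 𝕜 (L2 𝕜 d) := by
    ext1 f
    refine Lp.ext ((hT 0 f).trans (Eventually.of_forall fun x => ?_))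
    simp [hΦ.apply_zero]
  have hadd : ∀ s t, T (s + t) = (T s).comp (T t) := fun s t => by
    ext1 f
    refine Lp.ext ?_
    filter_upwards [hT (s + t) f, hT s (T t f), (hq s).ae (hT t f)] with x e1 e2 e3
    rw [e1, ContinuousLinearMap.comp_apply, e2]
    simp only [Function.comp_apply] at e3 ⊢
    rw [e3, ← hΦ.apply_add hL, add_comm]
  have hsmall : ∀ᶠ t in 𝓝 (0 : ℝ), |t| ≤ 1 := by
    have : Continuous fun t : ℝ => |t| := continuous_abs
    exact (this.tendsto 0).eventually (by simpa using ge_mem_nhds one_pos)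
  have hTb : ∀ᶠ t in 𝓝 (0 : ℝ), ‖T t‖ ≤
      (((Real.exp L).toNNReal ^ d : ℝ≥0) : ℝ) ^ (1 / 2 : ℝ) := by
    filter_upwards [hsmall] with t ht
    refine (hTn t).trans ?_
    gcongr
    exact mul_le_of_le_one_right L.coe_nonneg ht
  have hcont : ∀ f ∈ {f : L2 𝕜 d | ∃ φ, IsTestFunction φ ∧ f =ᵐ[volume] φ},
      Tendsto (fun t => T t f) (𝓝 0) (𝓝 f) := by
    rintro f ⟨φ, hφ, hf⟩
    obtain ⟨R, hR⟩ := exists_radius hφ.2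
    obtain ⟨C, hC⟩ := hφ.continuous.bounded_above_of_compact_support hφ.2
    refine tendsto_Lp_two_of_bounded (u := fun t x => φ (Φ t x))
      (Eventually.of_forall fun t => (hT t f).trans ((hq t).ae hf)) hf
      (K := Metric.closedBall 0 (R + M)) Metric.isClosed_closedBall.measurableSet
      measure_closedBall_lt_top.ne (C := C) (Eventually.of_forall fun t x => hC _) ?_
      (Eventually.of_forall fun x => ?_)
    · filter_upwards [hsmall] with t ht x hx
      refine hΦ.apply_eq_zero_of_large hM hR ?_
      have h1 : M * |t| ≤ M := mul_le_of_le_one_right M.coe_nonneg ht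
      have h2 : R + M < ‖x‖ := by simpa using hx
      linarith
    · have h1 := (hφ.continuous.comp (hΦ.continuous_time x)).tendsto 0
      simpa [hΦ.apply_zero, Function.comp_def] using h1
  have hG : IsC0Group T := isC0Group_of_dense h0 hadd hTb dense_testFunctions hcont
  have hGr := hG.restrictScalars
  -- The difference quotients of a `K`-Lipschitz `φ` along the flow are bounded by `K * M` and, for
  -- `|t| ≤ 1`, supported in a fixed ball, so pointwise differentiation gives the `L_2` derivative.
  have hderiv : ∀ p ∈ vectorFieldGraph 𝕜 (fun j x => B x j),
      InGenerator (fun t => (T t).restrictScalars ℝ) p.1 p.2 := by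
    rintro p ⟨φ, hφ, hp1, hp2⟩
    obtain ⟨R, hR⟩ := exists_radius hφ.2
    obtain ⟨K, hK⟩ := hφ.exists_lipschitz
    refine hasDerivAt_iff_tendsto_slope_zero.2 ?_
    refine tendsto_Lp_two_of_bounded (u := fun t x => t⁻¹ • (φ (Φ t x) - φ x))
      (Eventually.of_forall fun t => ?_) hp2
      (K := Metric.closedBall 0 (R + M)) Metric.isClosed_closedBall.measurableSet
      measure_closedBall_lt_top.ne (C := K * M) ?_ ?_ (Eventually.of_forall fun x => ?_)
    · simp only [ContinuousLinearMap.coe_restrictScalars', zero_add, h0,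
        ContinuousLinearMap.id_apply]
      filter_upwards [Lp.coeFn_smul t⁻¹ (T t p.1 - p.1), Lp.coeFn_sub (T t p.1) p.1, hT t p.1,
        (hq t).ae hp1, hp1] with x e1 e2 e3 e4 e5
      rw [e1, Pi.smul_apply, e2, Pi.sub_apply, e3, Function.comp_apply, e4, e5]
    · filter_upwards [self_mem_nhdsWithin] with t ht x
      have h1 : 0 < |t| := abs_pos.2 ht
      rw [norm_smul, norm_inv, Real.norm_eq_abs, inv_mul_le_iff₀ h1]
      calc ‖φ (Φ t x) - φ x‖ ≤ K * ‖Φ t x - x‖ := hK.norm_sub_le _ _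
        _ ≤ K * (M * |t|) := by gcongr; exact hΦ.norm_sub_le hM t x
        _ = |t| * (K * M) := by ring
    · filter_upwards [nhdsWithin_le_nhds hsmall] with t ht x hx
      have h1 : M * |t| ≤ M := mul_le_of_le_one_right M.coe_nonneg ht
      have h2 : R + M < ‖x‖ := by simpa using hx
      have hM0 : (0 : ℝ) ≤ M := M.coe_nonneg
      rw [hΦ.apply_eq_zero_of_large hM hR (by linarith), hR x (by linarith), sub_zero, smul_zero]
    · have h1 : HasDerivAt (fun t => φ (Φ t x)) (fderiv ℝ φ x (B x)) 0 := by
        have h2 := hΦ.hasDerivAt 0 x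
        have h3 := (hφ.differentiable (Φ 0 x)).hasFDerivAt.comp_hasDerivAt 0 h2
        simpa only [hΦ.apply_zero, Function.comp_def] using h3
      rw [vectorField_eq_fderiv]
      simpa [hΦ.apply_zero] using h1.tendsto_slope_zero
  refine ⟨T, ⟨hG, ?_⟩, fun t f g hfg => ?_⟩
  · refine Subset.antisymm ?_ ?_
    · rintro ⟨f, g⟩ hfg
      -- The generator is no larger than the closure: Lipschitz functions of compact support form a
      -- dense invariant set on which the closure is defined.
      refine hGr.generator_subset_of_invariant (graphSubmodule 𝕜 (fun j x => B x j)).topologicalClosure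
        (Submodule.isClosed_topologicalClosure _) ?_
        (D := {f | ∃ (φ : EuclideanSpace ℝ (Fin d) → 𝕜) (K : ℝ≥0), LipschitzWith K φ ∧
          HasCompactSupport φ ∧ f =ᵐ[volume] φ}) ?_ ?_ ?_ hfg
      · exact closure_minimal hderiv hGr.isClosed_generator
      · refine dense_testFunctions.mono ?_
        rintro f ⟨φ, hφ, hf⟩
        obtain ⟨K, hK⟩ := hφ.exists_lipschitz
        exact ⟨φ, K, hK, hφ.2, hf⟩
      · rintro f ⟨φ, K, hK, hφ, hf⟩ t
        obtain ⟨R, hR⟩ := exists_radius hφ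
        refine ⟨φ ∘ Φ t, _, hK.comp (hΦ.lipschitzWith hL t), ?_, (hT t f).trans ((hq t).ae hf)⟩
        exact HasCompactSupport.intro (isCompact_closedBall 0 (R + M * |t|)) fun x hx =>
          hΦ.apply_eq_zero_of_large hM hR (by simpa using hx)
      · rintro f ⟨φ, K, hK, hφ, hf⟩
        exact mem_closure_graph_of_lipschitz hbm (M := fun _ => M)
          (fun j x => (PiLp.norm_apply_le (B x) j).trans (hM x)) hK hφ hf
    · exact closure_minimal hderiv hGr.isClosed_generator
  · filter_upwards [hT t f, hT t g, (hq t).ae hfg] with x e1 e2 e3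
    rw [e1, e2]; exact e3

theorem norm_le_sum_norm_apply (w : EuclideanSpace ℝ (Fin d)) : ‖w‖ ≤ ∑ j, ‖w j‖ := by
  have h1 : w = ∑ j, w j • EuclideanSpace.single j (1 : ℝ) := by
    ext k
    simp [Pi.single_apply]
  conv_lhs => rw [h1]
  exact norm_sum_le_of_le _ fun j _ => by simp [norm_smul]

variable {b : Fin d → EuclideanSpace ℝ (Fin d) → ℝ}

theorem isFlow_congr {b' : Fin d → EuclideanSpace ℝ (Fin d) → ℝ} (h : ∀ j, b j =ᵐ[volume] b' j)
    {T : ℝ → L2 𝕜 d →L[𝕜] L2 𝕜 d} (hT : IsFlow b' T) : IsFlow b T :=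
  ⟨hT.isC0Group, by rw [hT.generator, vectorFieldGraph_congr h]⟩

theorem exists_isFlow (hb : ∀ j, MemW1Inf (b j)) : ∃ T : ℝ → L2 𝕜 d →L[𝕜] L2 𝕜 d, IsFlow b T ∧
    ∀ t f g, (∀ᵐ x, f x * g x = 0) → ∀ᵐ x, T t f x * T t g x = 0 := by
  choose v L M hv hL hM using fun j => (hb j).exists_lipschitz
  let B : EuclideanSpace ℝ (Fin d) → EuclideanSpace ℝ (Fin d) := fun x => WithLp.toLp 2 fun j => v j x
  have hBL : LipschitzWith (∑ j, L j) B := LipschitzWith.of_dist_le_mul fun x y => by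
    rw [dist_eq_norm, NNReal.coe_sum, Finset.sum_mul]
    refine (norm_le_sum_norm_apply _).trans (Finset.sum_le_sum fun j _ => ?_)
    exact (hL j).dist_le_mul x y
  have hBM : ∀ x, ‖B x‖ ≤ (∑ j, M j : ℝ≥0) := fun x => by
    rw [NNReal.coe_sum]
    exact (norm_le_sum_norm_apply _).trans (Finset.sum_le_sum fun j _ => hM j x)
  obtain ⟨Φ, hΦ⟩ := exists_globalFlow hBL hBM
  obtain ⟨T, hT, hT'⟩ := hΦ.exists_isFlow (𝕜 := 𝕜) hBL hBM
  exact ⟨T, isFlow_congr hv hT, hT'⟩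

namespace IsFlow

variable {T S : ℝ → L2 𝕜 d →L[𝕜] L2 𝕜 d}

theorem inGenerator_iff (hT : IsFlow b T) {f g : L2 𝕜 d} :
    InGenerator (fun t => (T t).restrictScalars ℝ) f g ↔ (f, g) ∈ closure (vectorFieldGraph 𝕜 b) := by
  rw [← hT.generator]; rfl

theorem dense_domain (hT : IsFlow b T) (hb : ∀ j, MemLp (b j) ⊤) :
    Dense {f | ∃ g, InGenerator (fun t => (T t).restrictScalars ℝ) f g} := by
  refine dense_testFunctions.mono ?_
  rintro f ⟨φ, hφ, hf⟩
  exact ⟨(memLp_vectorField hb hφ 2).toLp, hT.inGenerator_iff.2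
    (subset_closure ⟨φ, hφ, hf, (memLp_vectorField hb hφ 2).coeFn_toLp⟩)⟩

theorem unique (hb : ∀ j, MemLp (b j) ⊤) (hT : IsFlow b T) (hS : IsFlow b S) : T = S := by
  funext t
  ext1 f
  exact hT.isC0Group.restrictScalars.intertwine hS.isC0Group.restrictScalars
    (ContinuousLinearMap.id ℝ _) (fun f g h => hS.inGenerator_iff.2 (hT.inGenerator_iff.1 h))
    (hT.dense_domain hb) t f

end IsFlow

theorem existsUnique_isFlow (hb : ∀ j, MemW1Inf (b j)) :
    ∃! T : ℝ → L2 𝕜 d →L[𝕜] L2 𝕜 d, IsFlow b T := by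
  obtain ⟨T, hT, -⟩ := exists_isFlow (𝕜 := 𝕜) hb
  exact ⟨T, hT, fun S hS => hS.unique (fun j => (hb j).1) hT⟩

end Existence

/-! ### Invariance of `L_2(Ω)` as a weak differential equation -/

section WeakForm

variable {d : ℕ} {𝕜 : Type*} [RCLike 𝕜] {b v : Fin d → EuclideanSpace ℝ (Fin d) → ℝ}
  {Ω : Set (EuclideanSpace ℝ (Fin d))}

/-- The divergence of `χ b`, where `v j` is the weak derivative `∂_j b_j`. -/
def divForm (b v : Fin d → EuclideanSpace ℝ (Fin d) → ℝ) (χ : EuclideanSpace ℝ (Fin d) → 𝕜) :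
    EuclideanSpace ℝ (Fin d) → 𝕜 :=
  fun x => vectorField b χ x + (∑ j, v j x) • χ x

/-- The indicator function of `Ω` is a weak solution of `∑_j b_j ∂_j u = 0`. -/
def WeaklyInvariant (𝕜 : Type*) [RCLike 𝕜] (b v : Fin d → EuclideanSpace ℝ (Fin d) → ℝ)
    (Ω : Set (EuclideanSpace ℝ (Fin d))) : Prop :=
  ∀ χ : EuclideanSpace ℝ (Fin d) → 𝕜, IsTestFunction χ → ∫ x, Ω.indicator (divForm b v χ) x = 0

theorem memLp_finset_sum_top {ι : Type*} (s : Finset ι) {u : ι → EuclideanSpace ℝ (Fin d) → ℝ}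
    (hu : ∀ j, MemLp (u j) ⊤) : MemLp (fun x => ∑ j ∈ s, u j x) ⊤ :=
  memLp_finsetSum s fun j _ => hu j

theorem IsTestFunction.integrable_smul {F : Type*} [NormedAddCommGroup F] [NormedSpace ℝ F]
    {u : EuclideanSpace ℝ (Fin d) → ℝ} (hu : MemLp u ⊤) {χ : EuclideanSpace ℝ (Fin d) → F}
    (hχ : IsTestFunction χ) : Integrable (fun x => u x • χ x) :=
  memLp_one_iff_integrable.1 ((hχ.memLp 1).smul hu)

theorem HasWeakPartial.integral_smul {j : Fin d} {u w : EuclideanSpace ℝ (Fin d) → ℝ}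
    (h : HasWeakPartial j u w) (hu : MemLp u ⊤) (hw : MemLp w ⊤)
    {χ : EuclideanSpace ℝ (Fin d) → 𝕜} (hχ : IsTestFunction χ) :
    ∫ x, u x • partialDeriv j χ x = -∫ x, w x • χ x := by
  have key : ∀ A : 𝕜 →L[ℝ] ℝ, A (∫ x, u x • partialDeriv j χ x) = A (-∫ x, w x • χ x) := fun A => by
    have h1 := h _ (hχ.clm_comp A)
    rw [_root_.map_neg, ← A.integral_comp_comm ((hχ.partialDeriv j).integrable_smul hu),
      ← A.integral_comp_comm (hχ.integrable_smul hw)]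
    simpa only [_root_.map_smul, smul_eq_mul, partialDeriv_clm_comp A hχ] using h1
  exact RCLike.ext (key RCLike.reCLM) (key RCLike.imCLM)

theorem integrable_divForm (hb : ∀ j, MemLp (b j) ⊤) (hv : ∀ j, MemLp (v j) ⊤)
    {χ : EuclideanSpace ℝ (Fin d) → 𝕜} (hχ : IsTestFunction χ) : Integrable (divForm b v χ) :=
  (memLp_one_iff_integrable.1 (memLp_vectorField hb hχ 1)).add
    (hχ.integrable_smul (memLp_finset_sum_top _ hv))

/-- Integration by parts on the whole space. It is what makes every element of the closed graph a
weak solution. -/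
theorem weaklyInvariant_univ (hb : ∀ j, MemLp (b j) ⊤) (hv : ∀ j, MemLp (v j) ⊤)
    (hbv : ∀ j, HasWeakPartial j (b j) (v j)) : WeaklyInvariant 𝕜 b v univ := by
  intro χ hχ
  simp only [indicator_univ, divForm, vectorField, Finset.sum_smul]
  rw [integral_add (integrable_finsetSum _ fun j _ => (hχ.partialDeriv j).integrable_smul (hb j))
    (integrable_finsetSum _ fun j _ => hχ.integrable_smul (hv j)),
    integral_finsetSum _ fun j _ => (hχ.partialDeriv j).integrable_smul (hb j),
    integral_finsetSum _ fun j _ => hχ.integrable_smul (hv j)]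
  simp [(hbv _).integral_smul (hb _) (hv _) hχ]

theorem IsTestFunction.conj {φ : EuclideanSpace ℝ (Fin d) → 𝕜} (hφ : IsTestFunction φ) :
    IsTestFunction (fun x => conj (φ x)) :=
  hφ.clm_comp (RCLike.conjCLE (K := 𝕜)).toContinuousLinearMap

theorem vectorField_conj {φ : EuclideanSpace ℝ (Fin d) → 𝕜} (hφ : IsTestFunction φ)
    (x : EuclideanSpace ℝ (Fin d)) :
    vectorField b (fun x => conj (φ x)) x = conj (vectorField b φ x) := by
  have h1 := fun j => partialDeriv_clm_comp (RCLike.conjCLE (K := 𝕜)).toContinuousLinearMap hφ j x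
  simp only [ContinuousLinearEquiv.coe_coe, RCLike.conjCLE_apply] at h1
  simp only [vectorField, h1, map_sum, RCLike.conj_smul]

theorem divForm_mul {φ χ : EuclideanSpace ℝ (Fin d) → 𝕜} (hφ : IsTestFunction φ)
    (hχ : IsTestFunction χ) (x : EuclideanSpace ℝ (Fin d)) :
    divForm b v (fun x => conj (φ x) * χ x) x =
      conj (φ x) * divForm b v χ x + conj (vectorField b φ x) * χ x := by
  rw [divForm, vectorField_mul b hφ.conj.differentiable hχ.differentiable, vectorField_conj hφ,
    divForm, mul_add, mul_smul_comm]
  ring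

/-- The Leibniz rule collects the terms into the divergence of `conj φ χ b`; this links the weak
equation for the pair `(1_Ω φ, 1_Ω Y φ)` to the weak equation for `1_Ω`. -/
theorem inner_add_inner_eq {φ χ : EuclideanSpace ℝ (Fin d) → 𝕜} (hφ : IsTestFunction φ)
    (hχ : IsTestFunction χ) {f f' g g' g'' : L2 𝕜 d} (hf : f =ᵐ[volume] Ω.indicator φ)
    (hf' : f' =ᵐ[volume] Ω.indicator (vectorField b φ)) (hg : g =ᵐ[volume] χ)
    (hg' : g' =ᵐ[volume] vectorField b χ) (hg'' : g'' =ᵐ[volume] fun x => (∑ j, v j x : ℝ) * g x) :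
    inner 𝕜 f (g' + g'') + inner 𝕜 f' g =
      ∫ x, Ω.indicator (divForm b v (fun x => conj (φ x) * χ x)) x := by
  rw [L2.inner_def, L2.inner_def, ← integral_add (L2.integrable_inner _ _) (L2.integrable_inner _ _)]
  refine integral_congr_ae ?_
  filter_upwards [hf, hf', hg, hg', hg'', Lp.coeFn_add g' g''] with x h1 h2 h3 h4 h5 h6
  rw [h6, Pi.add_apply, h1, h2, h5, h3, h4]
  by_cases hx : x ∈ Ω
  · simp only [indicator_of_mem hx, RCLike.inner_apply]
    rw [divForm_mul hφ hχ, divForm, RCLike.real_smul_eq_coe_mul]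
    ring
  · simp [indicator_of_notMem hx]

/-- The pair `(f, g)` is a weak solution of `∑_j b_j ∂_j f = g`, where `A` is multiplication by the
divergence of `b`. -/
def IsWeakSolution (b : Fin d → EuclideanSpace ℝ (Fin d) → ℝ) (A : L2 𝕜 d →L[𝕜] L2 𝕜 d)
    (f g : L2 𝕜 d) : Prop :=
  ∀ q ∈ vectorFieldGraph 𝕜 b, inner 𝕜 f (q.2 + A q.1) + inner 𝕜 g q.1 = 0

variable {A P : L2 𝕜 d →L[𝕜] L2 𝕜 d}

theorem IsWeakSolution.inner_closure {f g : L2 𝕜 d} (h : IsWeakSolution b A f g) :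
    ∀ q ∈ closure (vectorFieldGraph 𝕜 b), inner 𝕜 f (q.2 + A q.1) + inner 𝕜 g q.1 = 0 := by
  refine closure_minimal (t := {q : L2 𝕜 d × L2 𝕜 d | inner 𝕜 f (q.2 + A q.1) + inner 𝕜 g q.1 = 0}) h
    (isClosed_eq ?_ continuous_const)
  fun_prop

theorem isClosed_isWeakSolution : IsClosed {p : L2 𝕜 d × L2 𝕜 d | IsWeakSolution b A p.1 p.2} := by
  simp only [IsWeakSolution, ofPred_forall]
  refine isClosed_biInter fun q _ => isClosed_eq ?_ continuous_const
  fun_prop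

theorem WeaklyInvariant.isWeakSolution (hΩ : WeaklyInvariant 𝕜 b v Ω)
    (hA : ∀ f, A f =ᵐ[volume] fun x => (∑ j, v j x : ℝ) * f x)
    {φ : EuclideanSpace ℝ (Fin d) → 𝕜} (hφ : IsTestFunction φ) {f f' : L2 𝕜 d}
    (hf : f =ᵐ[volume] Ω.indicator φ) (hf' : f' =ᵐ[volume] Ω.indicator (vectorField b φ)) :
    IsWeakSolution b A f f' := by
  rintro q ⟨χ, hχ, h1, h2⟩
  rw [inner_add_inner_eq hφ hχ hf hf' h1 h2 (hA q.1)]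
  exact hΩ _ (hφ.conj.mul hχ)

theorem isWeakSolution_of_mem_closure (huniv : WeaklyInvariant 𝕜 b v univ)
    (hA : ∀ f, A f =ᵐ[volume] fun x => (∑ j, v j x : ℝ) * f x) :
    ∀ p ∈ closure (vectorFieldGraph 𝕜 b), IsWeakSolution b A p.1 p.2 := by
  refine closure_minimal (t := {p : L2 𝕜 d × L2 𝕜 d | IsWeakSolution b A p.1 p.2}) ?_ isClosed_isWeakSolution
  rintro p ⟨φ, hφ, h1, h2⟩
  exact huniv.isWeakSolution hA hφ (by simpa using h1) (by simpa using h2)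

/-- Weak solutions are strong solutions. -/
theorem IsWeakSolution.mem_closure_graph {T : ℝ → L2 𝕜 d →L[𝕜] L2 𝕜 d} (hT : IsFlow b T)
    (hA : ∀ p ∈ closure (vectorFieldGraph 𝕜 b), IsWeakSolution b A p.1 p.2) {g h : L2 𝕜 d}
    (hw : IsWeakSolution b A g h) : (g, h) ∈ closure (vectorFieldGraph 𝕜 b) := by
  have hG := hT.isC0Group.restrictScalars
  -- The second resolvent, that of the reversed group, must be small enough to absorb `A`; `‖A‖ + 1`
  -- avoids division by zero.
  obtain ⟨c, hc1, hc2⟩ := ((hG.eventually_exists_resolvent one_pos).and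
    (hG.comp_neg.eventually_exists_resolvent
      (show 0 < 1 / (2 * (‖A‖ + 1)) by positivity))).exists
  -- With `Y` the generator, `g'` is the strong solution of `(c - Y) g' = c g - h`, which `g` solves
  -- weakly. So `z = g - g'` is a weak solution of `Y z = c z`, and `z = 0` has to be shown.
  obtain ⟨g', hg', -⟩ := hc1 (c • g - h)
  -- Here `(c + Y) η = z`. Testing the weak equation for `z` with `η` leaves `⟨z, z⟩ + ⟨z, A η⟩ =
  -- 0`, where `‖A η‖ ≤ ‖z‖ / 2`.
  obtain ⟨η, hη, hηn⟩ := hc2 (g - g')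
  set z := g - g' with hz
  have hηG : (η, z - c • η) ∈ closure (vectorFieldGraph 𝕜 b) := by
    rw [← hT.inGenerator_iff]
    have h1 : HasDerivAt (fun t => T (-t) η) (c • η - z) (0 - 0) := by
      rw [sub_zero]; exact hη
    simpa [InGenerator] using h1.comp_const_sub 0 0
  have e1 := hw.inner_closure _ hηG
  have e2 := (hA _ (hT.inGenerator_iff.1 hg')).inner_closure _ hηG
  dsimp only at e1 e2
  have e3 : inner 𝕜 z z + inner 𝕜 z (A η) = 0 := by
    have e4 : inner 𝕜 (c • z) η = inner 𝕜 z (c • η) := by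
      rw [RCLike.real_smul_eq_coe_smul (K := 𝕜) c z, RCLike.real_smul_eq_coe_smul (K := 𝕜) c η,
        inner_smul_left, inner_smul_right, RCLike.conj_ofReal]
    have e5 : c • z = h - (c • g' - (c • g - h)) := by rw [hz, smul_sub]; abel
    have e6 : inner 𝕜 z (z - c • η + A η) + inner 𝕜 (c • z) η = 0 := by
      rw [e5, inner_sub_left h]
      conv_lhs => rw [hz, inner_sub_left, ← hz]
      linear_combination e1 - e2
    rw [e4, ← inner_add_right] at e6
    rw [← inner_add_right, ← e6]
    congr 1
    abel
  have hz0 : z = 0 := by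
    by_contra hne
    have hzp : 0 < ‖z‖ := norm_pos_iff.2 hne
    have h1 : ‖z‖ * ‖z‖ ≤ ‖z‖ * (‖A‖ * ‖η‖) := by
      have h0 : ‖inner 𝕜 z z‖ = ‖z‖ * ‖z‖ := by
        rw [inner_self_eq_norm_sq_to_K, norm_pow, RCLike.norm_ofReal, abs_norm, sq]
      rw [← h0, eq_neg_of_add_eq_zero_left e3, norm_neg]
      refine (norm_inner_le_norm _ _).trans ?_
      gcongr
      exact A.le_opNorm η
    have h2 : ‖z‖ ≤ ‖A‖ * ‖η‖ := le_of_mul_le_mul_left h1 hzp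
    have h3 : ‖A‖ * ‖η‖ ≤ ‖A‖ * (1 / (2 * (‖A‖ + 1)) * ‖z‖) := by gcongr
    have h4 : ‖A‖ * (1 / (2 * (‖A‖ + 1)) * ‖z‖) ≤ 1 / 2 * ‖z‖ := by
      rw [← mul_assoc]
      gcongr
      rw [mul_one_div, div_le_iff₀ (by positivity)]
      linarith
    linarith
  have h1 := hT.inGenerator_iff.1 hg'
  rw [← sub_eq_zero.1 hz0] at h1
  simpa using h1

theorem mem_L2On_iff (hP : ∀ f, P f =ᵐ[volume] Ω.indicator f) (f : L2 𝕜 d) :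
    f ∈ L2On 𝕜 Ω ↔ P f = f := by
  constructor
  · intro hf
    refine Lp.ext ((hP f).trans ?_)
    filter_upwards [hf] with x hx
    by_cases hxΩ : x ∈ Ω
    · rw [indicator_of_mem hxΩ]
    · rw [indicator_of_notMem hxΩ, hx hxΩ]
  · intro hf
    change ∀ᵐ x, x ∉ Ω → f x = 0
    rw [← hf]
    filter_upwards [hP f] with x hx hxΩ
    rw [hx, indicator_of_notMem hxΩ]

theorem exists_indicatorOp (𝕜 : Type*) [RCLike 𝕜] (hΩ : NullMeasurableSet Ω) :
    ∃ P : L2 𝕜 d →L[𝕜] L2 𝕜 d, ∀ f, P f =ᵐ[volume] Ω.indicator f := by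
  obtain ⟨P, hP⟩ := exists_mulOp (μ := volume) (𝕜 := 𝕜) (a := Ω.indicator fun _ => 1)
    (memLp_top_of_bound ((aestronglyMeasurable_const (b := (1 : 𝕜))).indicator₀ hΩ) 1
      (Eventually.of_forall fun x => by
        by_cases hx : x ∈ Ω
        · simp [hx]
        · simp [hx]))
  refine ⟨P, fun f => (hP f).trans (Eventually.of_forall fun x => ?_)⟩
  by_cases hx : x ∈ Ω
  · simp [hx]
  · simp [hx]

/-- A group of operators that preserve disjointness of supports commutes with the projection onto an
invariant subspace `L_2(Ω)`. -/
theorem commute_of_image_eq {S : L2 𝕜 d →L[𝕜] L2 𝕜 d}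
    (hS : ∀ f g, (∀ᵐ x, f x * g x = 0) → ∀ᵐ x, S f x * S g x = 0)
    (himg : S '' L2On 𝕜 Ω = L2On 𝕜 Ω) (hP : ∀ f, P f =ᵐ[volume] Ω.indicator f) (f : L2 𝕜 d) :
    P (S f) = S (P f) := by
  have hPP : ∀ f, P f ∈ L2On 𝕜 Ω := fun f => by
    filter_upwards [hP f] with x hx hxΩ
    rw [hx, indicator_of_notMem hxΩ]
  have h1 : P (S (P f)) = S (P f) :=
    (mem_L2On_iff hP _).1 (himg ▸ mem_image_of_mem S (hPP f))
  -- Since `S` maps onto `L_2(Ω)`, this element is `S g` with `g` in `L_2(Ω)`, hence with support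
  -- disjoint from that of `f - P f`. Thus `S g` times `S (f - P f)` vanishes; on `Ω` this product
  -- is the square of `S (f - P f)`.
  have h2 : P (S (f - P f)) = 0 := by
    obtain ⟨g, hg, hgS⟩ : P (S (f - P f)) ∈ S '' L2On 𝕜 Ω := by
      rw [himg]; exact hPP _
    have h3 : ∀ᵐ x, g x * (f - P f) x = 0 := by
      filter_upwards [hg, hP f, Lp.coeFn_sub f (P f)] with x e1 e2 e3
      by_cases hx : x ∈ Ω
      · rw [e3, Pi.sub_apply, e2, indicator_of_mem hx, sub_self, mul_zero]
      · simp [e1 hx]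
    refine Lp.ext ?_
    have h4 := hS _ _ h3
    rw [hgS] at h4
    filter_upwards [h4, hP (S (f - P f)),
      Lp.coeFn_zero 𝕜 2 (volume : Measure (EuclideanSpace ℝ (Fin d)))] with x e1 e2 e3
    rw [e3, Pi.zero_apply]
    by_cases hx : x ∈ Ω
    · rw [e2, indicator_of_mem hx] at e1
      rw [e2, indicator_of_mem hx]
      exact mul_self_eq_zero.1 e1
    · rw [e2, indicator_of_notMem hx]
  have h5 : S f = S (P f) + S (f - P f) := by rw [← _root_.map_add]; simp
  rw [h5, _root_.map_add, h1, h2, add_zero]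

/-- A cut-off function that is equal to one on the ball of radius `R`. -/
theorem exists_cutoff (d : ℕ) (R : ℝ) : ∃ φ : EuclideanSpace ℝ (Fin d) → ℝ, IsTestFunction φ ∧
    ∀ x, ‖x‖ ≤ R → φ =ᶠ[𝓝 x] 1 := by
  let β : ContDiffBump (0 : EuclideanSpace ℝ (Fin d)) := ⟨|R| + 1, |R| + 2, by positivity, by linarith⟩
  refine ⟨β, ⟨β.contDiff, β.hasCompactSupport⟩, fun x hx => ?_⟩
  refine β.eventuallyEq_one_of_mem_ball ?_
  rw [mem_ball_zero_iff]
  have := le_abs_self R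
  change ‖x‖ < |R| + 1
  linarith

theorem partialDeriv_eq_zero_of_large {F : Type*} [NormedAddCommGroup F] [NormedSpace ℝ F]
    {χ : EuclideanSpace ℝ (Fin d) → F} {R : ℝ} (h : ∀ x, R < ‖x‖ → χ x = 0) (j : Fin d)
    {x : EuclideanSpace ℝ (Fin d)} (hx : R < ‖x‖) : partialDeriv j χ x = 0 := by
  have h1 : χ =ᶠ[𝓝 x] fun _ => 0 := by
    filter_upwards [continuous_norm.continuousAt.eventually (lt_mem_nhds hx)] with y hy
    exact h y hy
  rw [partialDeriv, h1.fderiv_eq]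
  simp

/-- The indicator of `Ω` need not be in `L_2`, so it is replaced by `1_Ω φ` with a cut-off `φ` equal
to one near the support of `χ`. Commutation puts `(P f, P f')` in the generator, hence among the
weak solutions. -/
theorem weaklyInvariant_of_commute {T : ℝ → L2 𝕜 d →L[𝕜] L2 𝕜 d} (hT : IsFlow b T)
    (hb : ∀ j, MemLp (b j) ⊤)
    (hA : ∀ f, A f =ᵐ[volume] fun x => (∑ j, v j x : ℝ) * f x)
    (hweak : ∀ p ∈ closure (vectorFieldGraph 𝕜 b), IsWeakSolution b A p.1 p.2)
    (hP : ∀ f, P f =ᵐ[volume] Ω.indicator f) (hcomm : ∀ t f, P (T t f) = T t (P f)) :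
    WeaklyInvariant 𝕜 b v Ω := by
  intro χ hχ
  obtain ⟨R, hR⟩ := exists_radius hχ.2
  obtain ⟨φ₀, hφ₀, hφ₁⟩ := exists_cutoff d R
  set φ : EuclideanSpace ℝ (Fin d) → 𝕜 := fun x => (φ₀ x : 𝕜) with hφdef
  have hφ : IsTestFunction φ := hφ₀.clm_comp (RCLike.ofRealCLM : ℝ →L[ℝ] 𝕜)
  set f : L2 𝕜 d := (hφ.memLp 2).toLp with hf
  set f' : L2 𝕜 d := (memLp_vectorField hb hφ 2).toLp with hf'
  have hff' : InGenerator (fun t => (T t).restrictScalars ℝ) f f' := hT.inGenerator_iff.2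
    (subset_closure ⟨φ, hφ, (hφ.memLp 2).coeFn_toLp, (memLp_vectorField hb hφ 2).coeFn_toLp⟩)
  have hPff' : InGenerator (fun t => (T t).restrictScalars ℝ) (P f) (P f') := by
    have h1 := (P.restrictScalars ℝ).hasFDerivAt.comp_hasDerivAt 0 hff'
    refine h1.congr_of_eventuallyEq (Eventually.of_forall fun t => ?_)
    simp [hcomm]
  have hw := hweak _ (hT.inGenerator_iff.1 hPff')
    ((hχ.memLp 2).toLp, (memLp_vectorField hb hχ 2).toLp)
    ⟨χ, hχ, (hχ.memLp 2).coeFn_toLp, (memLp_vectorField hb hχ 2).coeFn_toLp⟩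
  have hPf : P f =ᵐ[volume] Ω.indicator φ := by
    filter_upwards [hP f, (hφ.memLp 2).coeFn_toLp] with x e1 e2
    rw [e1]; simp only [indicator, hf, e2]
  have hPf' : P f' =ᵐ[volume] Ω.indicator (vectorField b φ) := by
    filter_upwards [hP f', (memLp_vectorField hb hφ 2).coeFn_toLp] with x e1 e2
    rw [e1]; simp only [indicator, hf', e2]
  rw [inner_add_inner_eq hφ hχ hPf hPf' (hχ.memLp 2).coeFn_toLp
    (memLp_vectorField hb hχ 2).coeFn_toLp (hA _)] at hw
  rw [← hw]
  congr 1
  ext x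
  -- On the ball of radius `R` the cut-off is locally one and its derivatives vanish; outside, `χ`
  -- and its derivatives vanish.
  have h2 : divForm b v χ x = divForm b v (fun x => conj (φ x) * χ x) x := by
    rw [divForm_mul hφ hχ]
    rcases le_or_gt ‖x‖ R with hx | hx
    · have h3 : φ =ᶠ[𝓝 x] fun _ => 1 := (hφ₁ x hx).mono fun y hy => by simp [hφdef, hy]
      have h4 : vectorField b φ x = 0 := by
        simp [vectorField, partialDeriv, h3.fderiv_eq]
      rw [h4, h3.self_of_nhds]
      simp
    · have h3 : divForm b v χ x = 0 := by
        simp [divForm, vectorField, hR x hx, partialDeriv_eq_zero_of_large hR _ hx]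
      simp [h3, hR x hx]
  simp only [indicator, h2]

theorem commute_of_weaklyInvariant {T : ℝ → L2 𝕜 d →L[𝕜] L2 𝕜 d} (hT : IsFlow b T)
    (hb : ∀ j, MemLp (b j) ⊤) (hA : ∀ f, A f =ᵐ[volume] fun x => (∑ j, v j x : ℝ) * f x)
    (hweak : ∀ p ∈ closure (vectorFieldGraph 𝕜 b), IsWeakSolution b A p.1 p.2)
    (hP : ∀ f, P f =ᵐ[volume] Ω.indicator f) (hΩ : WeaklyInvariant 𝕜 b v Ω) (t : ℝ) (f : L2 𝕜 d) :
    P (T t f) = T t (P f) := by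
  have hG := hT.isC0Group.restrictScalars
  refine hG.intertwine hG (P.restrictScalars ℝ) (fun f g hfg => ?_) (hT.dense_domain hb) t f
  rw [hT.inGenerator_iff] at hfg ⊢
  -- It suffices to treat test functions: `P` is bounded and the closed graph absorbs limits.
  have h1 : MapsTo (fun p : L2 𝕜 d × L2 𝕜 d => (P p.1, P p.2)) (closure (vectorFieldGraph 𝕜 b))
      (closure (closure (vectorFieldGraph 𝕜 b))) := by
    refine MapsTo.closure ?_ (by fun_prop)
    rintro p ⟨φ, hφ, h2, h3⟩
    refine (hΩ.isWeakSolution hA hφ ?_ ?_).mem_closure_graph hT hweak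
    · filter_upwards [hP p.1, h2] with x e1 e2
      rw [e1]; simp only [indicator, e2]
    · filter_upwards [hP p.2, h3] with x e1 e2
      rw [e1]; simp only [indicator, e2]
  rw [closure_closure] at h1
  exact h1 hfg

/-- The subspace `L_2(Ω)` is invariant under the flow with coefficients `b` if and only if the
indicator function of `Ω` is a weak solution of `∑_j b_j ∂_j u = 0`. -/
theorem image_L2On_eq_iff (hb : ∀ j, MemW1Inf (b j)) (hv : ∀ j, MemLp (v j) ⊤)
    (hbv : ∀ j, HasWeakPartial j (b j) (v j)) (hΩ : NullMeasurableSet Ω) :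
    (∀ T : ℝ → L2 𝕜 d →L[𝕜] L2 𝕜 d, IsFlow b T → ∀ t, T t '' L2On 𝕜 Ω = L2On 𝕜 Ω) ↔
      WeaklyInvariant 𝕜 b v Ω := by
  have hb' := fun j => (hb j).1
  obtain ⟨P, hP⟩ := exists_indicatorOp 𝕜 hΩ
  obtain ⟨A, hA⟩ : ∃ A : L2 𝕜 d →L[𝕜] L2 𝕜 d,
      ∀ f, A f =ᵐ[volume] fun x => (∑ j, v j x : ℝ) * f x :=
    exists_mulOp ((memLp_finset_sum_top Finset.univ hv).ofReal (K := 𝕜))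
  have hweak := isWeakSolution_of_mem_closure (weaklyInvariant_univ (𝕜 := 𝕜) hb' hv hbv) hA
  constructor
  · intro h
    obtain ⟨T, hT, hTd⟩ := exists_isFlow (𝕜 := 𝕜) hb
    exact weaklyInvariant_of_commute hT hb' hA hweak hP fun t =>
      commute_of_image_eq (hTd t) (h T hT t) hP
  · intro h T hT
    have hcomm := commute_of_weaklyInvariant hT hb' hA hweak hP h
    have hmaps : ∀ t, ∀ f ∈ L2On 𝕜 Ω, T t f ∈ L2On 𝕜 Ω := fun t f hf => by
      rw [mem_L2On_iff hP] at hf ⊢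
      rw [hcomm, hf]
    intro t
    refine Subset.antisymm (image_subset_iff.2 (hmaps t)) fun f hf => ⟨T (-t) f, hmaps _ f hf, ?_⟩
    exact hT.isC0Group.restrictScalars.apply_apply_neg t f

end WeakForm

/-! ### Passing between the fields `c_i` and `∑_i (∂_i ψ) c_i` -/

section GradCoeff

variable {d : ℕ} {𝕜 : Type*} [RCLike 𝕜]

theorem HasWeakPartial.mul_testFunction {j : Fin d} {u w ψ : EuclideanSpace ℝ (Fin d) → ℝ}
    (h : HasWeakPartial j u w) (hu : MemLp u ⊤) (hw : MemLp w ⊤) (hψ : IsTestFunction ψ) :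
    HasWeakPartial j (fun x => u x * ψ x) (fun x => w x * ψ x + u x * partialDeriv j ψ x) := by
  intro φ hφ
  have h1 := h _ (hψ.mul (𝕜 := ℝ) hφ)
  have i1 : Integrable fun x => u x * (ψ x * partialDeriv j φ x) :=
    (hψ.mul (𝕜 := ℝ) (hφ.partialDeriv j)).integrable_smul hu
  have i2 : Integrable fun x => u x * (partialDeriv j ψ x * φ x) :=
    ((hψ.partialDeriv j).mul (𝕜 := ℝ) hφ).integrable_smul hu
  have i3 : Integrable fun x => w x * (ψ x * φ x) := (hψ.mul (𝕜 := ℝ) hφ).integrable_smul hw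
  have e1 : ∀ x, u x * partialDeriv j (fun x => ψ x * φ x) x =
      u x * (ψ x * partialDeriv j φ x) + u x * (partialDeriv j ψ x * φ x) := fun x => by
    rw [partialDeriv_mul (𝕜 := ℝ) hψ.differentiable hφ.differentiable, mul_add]
  simp only [e1] at h1
  rw [integral_add i1 i2] at h1
  have e2 : ∀ x, (w x * ψ x + u x * partialDeriv j ψ x) * φ x =
      w x * (ψ x * φ x) + u x * (partialDeriv j ψ x * φ x) := fun x => by ring
  simp only [e2, mul_assoc]
  rw [integral_add i3 i2]
  linarith

theorem HasWeakPartial.finset_sum {j : Fin d} {ι : Type*} (s : Finset ι)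
    {u w : ι → EuclideanSpace ℝ (Fin d) → ℝ} (h : ∀ i, HasWeakPartial j (u i) (w i))
    (hu : ∀ i, MemLp (u i) ⊤) (hw : ∀ i, MemLp (w i) ⊤) :
    HasWeakPartial j (fun x => ∑ i ∈ s, u i x) (fun x => ∑ i ∈ s, w i x) := by
  intro φ hφ
  simp only [← smul_eq_mul, Finset.sum_smul]
  rw [integral_finsetSum _ fun i _ => (hφ.partialDeriv j).integrable_smul (hu i),
    integral_finsetSum _ fun i _ => hφ.integrable_smul (hw i), ← Finset.sum_neg_distrib]
  exact Finset.sum_congr rfl fun i _ => h i φ hφ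

/-- The weak derivatives `∂_j` of the coefficients `∑_i c_{ij} ∂_i ψ`, where `w i j` is the weak
derivative `∂_j c_{ij}`. -/
def gradCoeffDeriv (c w : Fin d → Fin d → EuclideanSpace ℝ (Fin d) → ℝ)
    (ψ : EuclideanSpace ℝ (Fin d) → ℝ) : Fin d → EuclideanSpace ℝ (Fin d) → ℝ :=
  fun j x => ∑ i, (w i j x * partialDeriv i ψ x + c i j x * partialDeriv j (partialDeriv i ψ) x)

variable {c w : Fin d → Fin d → EuclideanSpace ℝ (Fin d) → ℝ} {ψ : EuclideanSpace ℝ (Fin d) → ℝ}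

theorem IsTestFunction.memLp_top_mul {u : EuclideanSpace ℝ (Fin d) → ℝ} (hψ : IsTestFunction ψ)
    (hu : MemLp u ⊤) : MemLp (fun x => u x * ψ x) ⊤ :=
  (hψ.memLp ⊤).smul hu

theorem memLp_gradCoeff (hc : ∀ i j, MemLp (c i j) ⊤) (hψ : IsTestFunction ψ) (j : Fin d) :
    MemLp (gradCoeff c ψ j) ⊤ :=
  memLp_finset_sum_top _ fun i => (hψ.partialDeriv i).memLp_top_mul (hc i j)

theorem memLp_gradCoeffDeriv (hc : ∀ i j, MemLp (c i j) ⊤) (hw : ∀ i j, MemLp (w i j) ⊤)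
    (hψ : IsTestFunction ψ) (j : Fin d) : MemLp (gradCoeffDeriv c w ψ j) ⊤ :=
  memLp_finset_sum_top _ fun i => ((hψ.partialDeriv i).memLp_top_mul (hw i j)).add
    (((hψ.partialDeriv i).partialDeriv j).memLp_top_mul (hc i j))

theorem memW1Inf_gradCoeff (hc : ∀ i j, MemW1Inf (c i j)) (hψ : IsTestFunction ψ) (j : Fin d) :
    MemW1Inf (gradCoeff c ψ j) := by
  refine ⟨memLp_gradCoeff (fun i j => (hc i j).1) hψ j, fun k => ?_⟩
  choose w hw hcw using fun i => (hc i j).2 k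
  exact ⟨_, memLp_finset_sum_top _ fun i => ((hψ.partialDeriv i).memLp_top_mul (hw i)).add
      (((hψ.partialDeriv i).partialDeriv k).memLp_top_mul (hc i j).1),
    HasWeakPartial.finset_sum _
      (fun i => (hcw i).mul_testFunction (hc i j).1 (hw i) (hψ.partialDeriv i))
      (fun i => (hψ.partialDeriv i).memLp_top_mul (hc i j).1)
      fun i => ((hψ.partialDeriv i).memLp_top_mul (hw i)).add
        (((hψ.partialDeriv i).partialDeriv k).memLp_top_mul (hc i j).1)⟩

theorem hasWeakPartial_gradCoeff (hc : ∀ i j, MemLp (c i j) ⊤) (hw : ∀ i j, MemLp (w i j) ⊤)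
    (hcw : ∀ i j, HasWeakPartial j (c i j) (w i j)) (hψ : IsTestFunction ψ) (j : Fin d) :
    HasWeakPartial j (gradCoeff c ψ j) (gradCoeffDeriv c w ψ j) :=
  HasWeakPartial.finset_sum _
    (fun i => (hcw i j).mul_testFunction (hc i j) (hw i j) (hψ.partialDeriv i))
    (fun i => (hψ.partialDeriv i).memLp_top_mul (hc i j))
    fun i => ((hψ.partialDeriv i).memLp_top_mul (hw i j)).add
      (((hψ.partialDeriv i).partialDeriv j).memLp_top_mul (hc i j))

/-- Both sides are the divergence of `χ ∑_i (∂_i ψ) c_i`; the second derivatives of `ψ` come from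
the weak derivative of the coefficients on the left and from the Leibniz rule on the right. -/
theorem divForm_gradCoeff (hψ : IsTestFunction ψ) {χ : EuclideanSpace ℝ (Fin d) → 𝕜}
    (hχ : IsTestFunction χ) (x : EuclideanSpace ℝ (Fin d)) :
    divForm (gradCoeff c ψ) (gradCoeffDeriv c w ψ) χ x =
      ∑ i, divForm (c i) (w i) (fun x => partialDeriv i ψ x • χ x) x := by
  simp only [divForm, vectorField, gradCoeff, gradCoeffDeriv,
    partialDeriv_smul (hψ.partialDeriv _).differentiable hχ.differentiable, Finset.sum_smul,
    ← Finset.sum_add_distrib]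
  rw [Finset.sum_comm]
  refine Finset.sum_congr rfl fun i _ => Finset.sum_congr rfl fun j _ => ?_
  module

/-- Weak invariance under the coordinate vector fields is equivalent to weak invariance under all
vector fields with coefficients `gradCoeff c ψ`. -/
theorem weaklyInvariant_gradCoeff_iff (hc : ∀ i j, MemLp (c i j) ⊤) (hw : ∀ i j, MemLp (w i j) ⊤)
    {Ω : Set (EuclideanSpace ℝ (Fin d))} (hΩ : NullMeasurableSet Ω) :
    (∀ i, WeaklyInvariant 𝕜 (c i) (w i) Ω) ↔ ∀ ψ : EuclideanSpace ℝ (Fin d) → ℝ,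
      IsTestFunction ψ → WeaklyInvariant 𝕜 (gradCoeff c ψ) (gradCoeffDeriv c w ψ) Ω := by
  constructor
  · intro h ψ hψ χ hχ
    have hχi : ∀ i, IsTestFunction fun x => partialDeriv i ψ x • χ x := fun i =>
      IsTestFunction.smul (hψ.partialDeriv i).1 hχ
    have e : ∀ x, Ω.indicator (divForm (gradCoeff c ψ) (gradCoeffDeriv c w ψ) χ) x =
        ∑ i, Ω.indicator (divForm (c i) (w i) (fun x => partialDeriv i ψ x • χ x)) x := fun x => by
      by_cases hx : x ∈ Ω
      · simp only [indicator_of_mem hx, divForm_gradCoeff hψ hχ]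
      · simp [indicator_of_notMem hx]
    simp only [e]
    rw [integral_finsetSum _ fun i _ =>
      (integrable_divForm (hc i) (hw i) (hχi i)).indicator₀ hΩ]
    exact Finset.sum_eq_zero fun i _ => h i _ (hχi i)
  · intro h i χ hχ
    obtain ⟨R, hR⟩ := exists_radius hχ.2
    obtain ⟨φ, hφ, hφ₁⟩ := exists_cutoff d R
    have hcoord : ContDiff ℝ ∞ fun x : EuclideanSpace ℝ (Fin d) => x i :=
      (EuclideanSpace.proj i : EuclideanSpace ℝ (Fin d) →L[ℝ] ℝ).contDiff
    -- The choice `ψ = x_i φ` gives `∂_k ψ = δ_{ki}` wherever `χ` is nonzero, so only the summand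
    -- `divForm (c i) (w i) χ` survives.
    have hψ : IsTestFunction fun x : EuclideanSpace ℝ (Fin d) => x i * φ x :=
      IsTestFunction.smul hcoord hφ
    rw [← h _ hψ χ hχ]
    congr 1
    ext x
    have e : ∀ k, (fun x => partialDeriv k (fun x : EuclideanSpace ℝ (Fin d) => x i * φ x) x • χ x) =
        if k = i then χ else fun _ => 0 := fun k => by
      funext y
      rcases le_or_gt ‖y‖ R with hy | hy
      · have h1 : (fun x : EuclideanSpace ℝ (Fin d) => x i * φ x) =ᶠ[𝓝 y] fun x => x i :=
          (hφ₁ y hy).mono fun z hz => by simp [hz]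
        have h2 := (EuclideanSpace.proj i : EuclideanSpace ℝ (Fin d) →L[ℝ] ℝ).hasFDerivAt (x := y)
        have h3 : partialDeriv k (fun x : EuclideanSpace ℝ (Fin d) => x i * φ x) y =
            if k = i then 1 else 0 := by
          have h4 : fderiv ℝ (fun x : EuclideanSpace ℝ (Fin d) => x i) y =
            (EuclideanSpace.proj i : EuclideanSpace ℝ (Fin d) →L[ℝ] ℝ) := h2.fderiv
          rw [partialDeriv, h1.fderiv_eq, h4]
          simp [eq_comm]
        rw [h3]
        split_ifs <;> simp
      · split_ifs <;> simp [hR y hy]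
    have e0 : ∀ k, divForm (c k) (w k) (fun _ => (0 : 𝕜)) x = 0 := fun k => by
      simp [divForm, vectorField, partialDeriv]
    have e1 : divForm (c i) (w i) χ x = divForm (gradCoeff c fun x => x i * φ x)
        (gradCoeffDeriv c w fun x => x i * φ x) χ x := by
      rw [divForm_gradCoeff hψ hχ, Finset.sum_eq_single i]
      · rw [e i, if_pos rfl]
      · intro k _ hk
        rw [e k, if_neg hk, e0]
      · simp
    simp only [indicator, e1]

end GradCoeff

end CoordinateFlows

end

/-- `T^{(i)}` is the flow with coefficients `c i`, that is, the group generated by the closure of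
`Y_i = ∑_j c_{ij} ∂_j`; `T^ψ` is the flow with coefficients `gradCoeff c ψ`, that is, the group
generated by the closure of `Y_ψ = ∑_{i,j} c_{ij} (∂_i ψ) ∂_j`. These groups exist and are unique,
and `L_2(Ω)` is invariant under all `T^{(i)}` if and only if it is invariant under all `T^ψ`. -/
theorem proposition6 {𝕜 : Type*} [RCLike 𝕜] (d : ℕ)
    (c : Fin d → Fin d → EuclideanSpace ℝ (Fin d) → ℝ)
    (hc : ∀ i j, CoordinateFlows.MemW1Inf (c i j))
    (Ω : Set (EuclideanSpace ℝ (Fin d))) (hΩ : MeasureTheory.NullMeasurableSet Ω) :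
    (∀ i : Fin d, ∃! T : ℝ → CoordinateFlows.L2 𝕜 d →L[𝕜] CoordinateFlows.L2 𝕜 d,
      CoordinateFlows.IsFlow (c i) T) ∧
    (∀ ψ : EuclideanSpace ℝ (Fin d) → ℝ, CoordinateFlows.IsTestFunction ψ →
      ∃! T : ℝ → CoordinateFlows.L2 𝕜 d →L[𝕜] CoordinateFlows.L2 𝕜 d,
        CoordinateFlows.IsFlow (CoordinateFlows.gradCoeff c ψ) T) ∧
    ((∀ (i : Fin d) (T : ℝ → CoordinateFlows.L2 𝕜 d →L[𝕜] CoordinateFlows.L2 𝕜 d),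
        CoordinateFlows.IsFlow (c i) T →
          ∀ t : ℝ, T t '' CoordinateFlows.L2On 𝕜 Ω = CoordinateFlows.L2On 𝕜 Ω) ↔
      (∀ ψ : EuclideanSpace ℝ (Fin d) → ℝ, CoordinateFlows.IsTestFunction ψ →
        ∀ T : ℝ → CoordinateFlows.L2 𝕜 d →L[𝕜] CoordinateFlows.L2 𝕜 d,
          CoordinateFlows.IsFlow (CoordinateFlows.gradCoeff c ψ) T →
            ∀ t : ℝ, T t '' CoordinateFlows.L2On 𝕜 Ω = CoordinateFlows.L2On 𝕜 Ω)) := by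
  have hc' := fun i j => (hc i j).1
  choose w hw hcw using fun i j => (hc i j).2 j
  refine ⟨fun i => CoordinateFlows.existsUnique_isFlow (hc i), fun ψ hψ =>
    CoordinateFlows.existsUnique_isFlow (CoordinateFlows.memW1Inf_gradCoeff hc hψ), ?_⟩
  refine Iff.trans (forall_congr' fun i =>
    CoordinateFlows.image_L2On_eq_iff (hc i) (hw i) (hcw i) hΩ) ?_
  refine (CoordinateFlows.weaklyInvariant_gradCoeff_iff hc' hw hΩ).trans ?_
  exact forall_congr' fun ψ => forall_congr' fun hψ =>
    (CoordinateFlows.image_L2On_eq_iff (CoordinateFlows.memW1Inf_gradCoeff hc hψ)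
      (CoordinateFlows.memLp_gradCoeffDeriv hc' hw hψ)
      (CoordinateFlows.hasWeakPartial_gradCoeff hc' hw hcw hψ) hΩ).symm
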